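/- Let $\mathcal H\neq\{0\}$ be a finite-dimensional complex Hilbert space, let $X=\mathcal I_1(\mathcal H)$ be the space of all operators on $\mathcal H$ with the trace norm $\|\eta\|_1=\operatorname{Tr}\big((\eta^*\eta)^{1/2}\big)$, and let $\|\cdot\|$ be the induced operator norm on $\mathcal B(X)$. Let $S^1\subset\mathbb C$ be the unit circle. A linear map on $X$ is CPTP if it is completely positive and trace preserving; it is irreducible if the only orthogonal projections $p$ of $\mathcal H$ for which it maps $pXp$ into itself are $p=0$ and $p=\mathrm{Id}$. For $A\in\mathcal B(X)$ and $e\in\operatorname{sp}A$, let $P_{e,A}=\frac1{2\pi i}\oint(z-A)^{-1}\,dz$ be the spectral projector of $A$ on $\{e\}$, where the integral is over a circle around $e$ enclosing no other point of $\operatorname{sp}A$. Put $P_A=\sum_{e\in\operatorname{sp}A\cap S^1}P_{e,A}$ and $Q_A=\mathrm{Id}-P_A$. For a map $s\mapsto\mathcal L(s)\in\mathcal B(X)$ on $[0,1]$ write $P(s)=P_{\mathcal L(s)}$ and $Q(s)=Q_{\mathcal L(s)}$, and consider the following conditions ($C^2$ on $[0,1]$ is understood with one-sided derivatives at the end points):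 - **H1.** $\|\mathcal L(s)\|\le 1$ for every $s\in[0,1]$. - **H2.** There is $\epsilon>0$ such that for every $s\in[0,1]$ each $e\in\operatorname{sp}\mathcal L(s)\cap S^1$ is a simple eigenvalue (algebraic multiplicity one), and $|e-e'|>2\epsilon$ for all $e\ne e'$ in $\operatorname{sp}\mathcal L(s)\cap S^1$. - **H3.** The map $s\mapsto\mathcal L(s)P(s)$ is $C^2$ on $[0,1]$. - **H4.** $\sup_{s\in[0,1]}\|\mathcal L(s)Q(s)\|<1$. - **wH4.** $\ell':=\sup_{s\in[0,1]}\operatorname{spr}\big(\mathcal L(s)Q(s)\big)<1$, where $\operatorname{spr}$ is the spectral radius. **Proposition.** Let $s\mapsto\mathcal L(s)\in\mathcal B(X)$ be $C^2$ on $[0,1]$, with each $\mathcal L(s)$ an irreducible CPTP map. 1. If $s\mapsto\mathcal L(s)$ satisfies H4, then it satisfies H1, H2, H3 and H4. 2. If $s\mapsto\mathcal L(s)$ satisfies wH4, then for every $\ell\in(\ell',1)$ there is an integer $m\ge1$ such that $s\mapsto\mathcal L(s)^m$ satisfies H1, H2, H3 and H4, with $\sup_{s\in[0,1]}\|\mathcal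 L(s)^mQ_{\mathcal L(s)^m}\|\le\ell$. 3. If $s\mapsto\mathcal L(s)$ satisfies H4 or wH4, then there is an integer $z\ge1$ such that for all $s\in[0,1]$ $$\operatorname{sp}\mathcal L(s)\cap S^1=S_z:=\{\exp(2\pi i k/z): k=0,1,\dots,z-1\}.$$ -/

import Mathlib

open Set Filter Topology

noncomputable section

section TraceNorm

variable {H : Type*} [NormedAddCommGroup H] [InnerProductSpace ℂ H] [CompleteSpace H]

/-- The trace norm `Tr ((A* A)^(1/2))` of an operator on a finite-dimensional Hilbert space. -/
def traceNorm (A : H →L[ℂ] H) : ℝ :=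
  (LinearMap.trace ℂ H (CFC.abs A).toLinearMap).re

variable [FiniteDimensional ℂ H]

/-- An orthonormal eigenbasis of `|A|`: it exhibits the trace norm as the sum of the singular
values of `A`. -/
theorem exists_basis_traceNorm (A : H →L[ℂ] H) :
    ∃ (b : OrthonormalBasis (Fin (Module.finrank ℂ H)) ℂ H) (σ : Fin (Module.finrank ℂ H) → ℝ),
      (∀ i, 0 ≤ σ i) ∧ (∀ i j, inner ℂ (A (b i)) (A (b j)) = if i = j then (σ i : ℂ) ^ 2 else 0) ∧
      (∀ i, ‖A (b i)‖ = σ i) ∧ traceNorm A = ∑ i, σ i := by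
  have hpos : (CFC.abs A).IsPositive :=
    (ContinuousLinearMap.nonneg_iff_isPositive _).1 (CFC.abs_nonneg A)
  have hsym : (CFC.abs A).toLinearMap.IsSymmetric := hpos.isSymmetric
  set b := hsym.eigenvectorBasis rfl with hb
  set σ := hsym.eigenvalues rfl with hσ
  have hbσ : ∀ i, CFC.abs A (b i) = (σ i : ℂ) • b i := fun i =>
    hsym.apply_eigenvectorBasis rfl i
  have hσ0 : ∀ i, 0 ≤ σ i := by
    intro i
    have h := hpos.re_inner_nonneg_right (b i)
    rw [hbσ, inner_smul_right, inner_self_eq_norm_sq_to_K, b.norm_eq_one] at h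
    simpa using h
  have hinner : ∀ i j, inner ℂ (A (b i)) (A (b j)) = if i = j then (σ i : ℂ) ^ 2 else 0 := by
    intro i j
    have h1 : inner ℂ (A (b i)) (A (b j)) = inner ℂ (b i) ((star A * A) (b j)) := by
      change _ = inner ℂ (b i) (star A (A (b j)))
      rw [ContinuousLinearMap.star_eq_adjoint, ContinuousLinearMap.adjoint_inner_right]
    rw [h1, ← CFC.abs_mul_abs]
    change inner ℂ (b i) (CFC.abs A (CFC.abs A (b j))) = _
    rw [hbσ, map_smul, hbσ, inner_smul_right, inner_smul_right, orthonormal_iff_ite.1 b.orthonormal]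
    by_cases hij : i = j
    · subst hij; simp [sq]
    · simp [hij]
  refine ⟨b, σ, hσ0, hinner, fun i => ?_, ?_⟩
  · have h := hinner i i
    rw [inner_self_eq_norm_sq_to_K, if_pos rfl] at h
    have h' : ‖A (b i)‖ ^ 2 = σ i ^ 2 := by
      rw [← Complex.ofReal_inj, Complex.ofReal_pow, Complex.ofReal_pow]
      exact h
    exact (pow_left_inj₀ (norm_nonneg _) (hσ0 i) two_ne_zero).1 h'
  · rw [traceNorm, hsym.trace_eq_sum_eigenvalues rfl]
    simp [hσ]

/-- A contraction pairs with `A` to at most the trace norm of `A`. -/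
theorem re_trace_mul_le_traceNorm (W A : H →L[ℂ] H) (hW : ∀ x, ‖W x‖ ≤ ‖x‖) :
    (LinearMap.trace ℂ H (W * A).toLinearMap).re ≤ traceNorm A := by
  obtain ⟨b, σ, -, -, hn, ht⟩ := exists_basis_traceNorm A
  rw [LinearMap.trace_eq_sum_inner _ b, Complex.re_sum, ht]
  refine Finset.sum_le_sum fun i _ => ?_
  calc (inner ℂ (b i) (W (A (b i)))).re ≤ ‖inner ℂ (b i) (W (A (b i)))‖ := Complex.re_le_norm _
    _ ≤ ‖b i‖ * ‖W (A (b i))‖ := norm_inner_le_norm _ _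
    _ ≤ 1 * ‖A (b i)‖ := by rw [b.norm_eq_one]; gcongr; exact hW _
    _ = σ i := by rw [one_mul, hn]

/-- The trace norm is attained by pairing with a contraction. -/
theorem exists_contraction_traceNorm (A : H →L[ℂ] H) :
    ∃ W : H →L[ℂ] H, (∀ x, ‖W x‖ ≤ ‖x‖) ∧
      traceNorm A = (LinearMap.trace ℂ H (W * A).toLinearMap).re := by
  obtain ⟨b, σ, h0, hin, hn, ht⟩ := exists_basis_traceNorm A
  let W : H →L[ℂ] H := ∑ i, ((σ i)⁻¹ : ℂ) • (innerSL ℂ (A (b i))).smulRight (b i)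
  have hWx : ∀ x, W x = ∑ i, (((σ i)⁻¹ : ℂ) * inner ℂ (A (b i)) x) • b i := by
    intro x
    simp [W, smul_smul]
  refine ⟨W, fun x => ?_, ?_⟩
  · let v : {i // σ i ≠ 0} → H := fun i => ((σ i)⁻¹ : ℂ) • A (b i)
    have hv : Orthonormal ℂ v := by
      rw [orthonormal_iff_ite]
      intro i j
      simp only [v, inner_smul_left, inner_smul_right, hin, Subtype.ext_iff]
      by_cases hij : i.1 = j.1
      · have hi : (σ j : ℂ) ≠ 0 := by exact_mod_cast j.2
        simp [hij]
        field_simp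
      · simp [hij]
    have hsq : ‖W x‖ ^ 2 = ∑ i, ‖((σ i)⁻¹ : ℂ) * inner ℂ (A (b i)) x‖ ^ 2 := by
      rw [hWx, ← b.sum_sq_norm_inner_right]
      refine Finset.sum_congr rfl fun i _ => ?_
      rw [inner_sum, Finset.sum_eq_single i]
      · simp [inner_smul_right]
      · intro j _ hj
        rw [inner_smul_right, orthonormal_iff_ite.1 b.orthonormal, if_neg (Ne.symm hj), mul_zero]
      · simp
    have hle : ‖W x‖ ^ 2 ≤ ‖x‖ ^ 2 := by
      rw [hsq]
      refine le_trans (le_of_eq ?_) (hv.sum_inner_products_le x (s := Finset.univ))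
      have hs : ∑ i : {i // σ i ≠ 0}, ‖inner ℂ (v i) x‖ ^ 2
          = ∑ i ∈ Finset.univ.filter (fun i => σ i ≠ 0),
            ‖((σ i)⁻¹ : ℂ) * inner ℂ (A (b i)) x‖ ^ 2 := by
        rw [← Finset.sum_subtype_eq_sum_filter, Finset.subtype_univ]
        refine Finset.sum_congr rfl fun i _ => ?_
        simp [v, mul_comm]
      rw [hs, Finset.sum_filter_of_ne]
      intro i _ hi h
      simp [h] at hi
    exact (pow_le_pow_iff_left₀ (norm_nonneg _) (norm_nonneg _) two_ne_zero).1 hle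
  · rw [LinearMap.trace_eq_sum_inner _ b, ht, Complex.re_sum]
    refine Finset.sum_congr rfl fun i _ => ?_
    change σ i = (inner ℂ (b i) (W (A (b i)))).re
    rw [hWx, Finset.sum_eq_single i]
    · rw [hin, if_pos rfl, inner_smul_right, inner_self_eq_norm_sq_to_K, b.norm_eq_one]
      by_cases hi : σ i = 0
      · simp [hi]
      · have hi' : (σ i : ℂ) ≠ 0 := by exact_mod_cast hi
        have : ((σ i)⁻¹ : ℂ) * (σ i : ℂ) ^ 2 = σ i := by field_simp
        rw [this]
        simp
    · intro j _ hj
      rw [hin, if_neg hj]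
      simp
    · simp

end TraceNorm

/-- The Banach space `I₁(H)` of trace-class operators on a finite-dimensional Hilbert space `H`
(that is, of all operators on `H`), to be normed by the trace norm. -/
def TraceClass (H : Type*) [NormedAddCommGroup H] [InnerProductSpace ℂ H] : Type _ :=
  H →L[ℂ] H

namespace TraceClass

variable {H : Type*} [NormedAddCommGroup H] [InnerProductSpace ℂ H]

instance : AddCommGroup (TraceClass H) := inferInstanceAs (AddCommGroup (H →L[ℂ] H))

instance : Module ℂ (TraceClass H) := inferInstanceAs (Module ℂ (H →L[ℂ] H))

/-- The identity map from `I₁(H)` to the operators on `H`. -/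
def toOp : TraceClass H ≃ₗ[ℂ] (H →L[ℂ] H) := LinearEquiv.refl ℂ (H →L[ℂ] H)

instance [FiniteDimensional ℂ H] : FiniteDimensional ℂ (TraceClass H) :=
  inferInstanceAs (FiniteDimensional ℂ (H →L[ℂ] H))

variable [CompleteSpace H]

instance : Norm (TraceClass H) := ⟨fun A => traceNorm (toOp A)⟩

theorem norm_def (A : TraceClass H) : ‖A‖ = traceNorm (toOp A) := rfl

variable [FiniteDimensional ℂ H]

theorem normCore : NormedSpace.Core ℂ (TraceClass H) where
  norm_nonneg A := by
    obtain ⟨b, σ, h0, -, -, ht⟩ := exists_basis_traceNorm (toOp A)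
    rw [norm_def, ht]
    exact Finset.sum_nonneg fun i _ => h0 i
  norm_smul c A := by
    rw [norm_def, norm_def, map_smul, traceNorm, traceNorm, CFC.abs_smul]
    have : ((‖c‖ • CFC.abs (toOp A) : H →L[ℂ] H) : H →ₗ[ℂ] H)
        = (‖c‖ : ℂ) • (CFC.abs (toOp A) : H →L[ℂ] H).toLinearMap := by
      ext x
      simp
    rw [this, map_smul, smul_eq_mul, Complex.re_ofReal_mul]
  norm_triangle A B := by
    obtain ⟨W, hW, ht⟩ := exists_contraction_traceNorm (toOp (A + B))
    rw [norm_def, ht, map_add, mul_add, ContinuousLinearMap.toLinearMap_add, map_add,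
      Complex.add_re]
    exact add_le_add (re_trace_mul_le_traceNorm W _ hW) (re_trace_mul_le_traceNorm W _ hW)
  norm_eq_zero_iff A := by
    constructor
    · intro h
      obtain ⟨b, σ, h0, -, hn, ht⟩ := exists_basis_traceNorm (toOp A)
      rw [norm_def, ht, Finset.sum_eq_zero_iff_of_nonneg fun i _ => h0 i] at h
      apply toOp.injective
      rw [map_zero]
      have hz : (toOp A).toLinearMap = 0 := by
        refine b.toBasis.ext fun i => ?_
        have := hn i
        rw [h i (Finset.mem_univ i), norm_eq_zero] at this
        simpa using this
      ext x
      exact LinearMap.congr_fun hz x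
    · rintro rfl
      rw [norm_def, map_zero, traceNorm, CFC.abs_zero]
      simp

instance : NormedAddCommGroup (TraceClass H) := NormedAddCommGroup.ofCore normCore

instance : NormedSpace ℂ (TraceClass H) := NormedSpace.ofCore normCore

end TraceClass

section Channels

variable {H : Type*} [NormedAddCommGroup H] [InnerProductSpace ℂ H] [CompleteSpace H]
  [FiniteDimensional ℂ H]

/-- Completely positive and trace preserving maps on `I₁(H)`. Complete positivity is that of maps
of the C*-algebra of all operators on `H`. -/
def IsCPTP (Φ : TraceClass H →L[ℂ] TraceClass H) : Prop :=
  (∃ φ : CompletelyPositiveMap (H →L[ℂ] H) (H →L[ℂ] H),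
      ∀ A : TraceClass H, (Φ A).toOp = φ A.toOp) ∧
    ∀ A : TraceClass H,
      LinearMap.trace ℂ H (Φ A).toOp.toLinearMap = LinearMap.trace ℂ H A.toOp.toLinearMap

/-- `Φ` is irreducible: the only orthogonal projections `p` of `H` for which `Φ` maps
`p I₁(H) p` into itself are `0` and the identity. -/
def IsIrreducibleMap (Φ : TraceClass H →L[ℂ] TraceClass H) : Prop :=
  ∀ p : H →L[ℂ] H, IsStarProjection p →
    (∀ A : H →L[ℂ] H, ∃ B : H →L[ℂ] H,
      (Φ (TraceClass.toOp.symm (p * A * p))).toOp = p * B * p) →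
    p = 0 ∨ p = 1

end Channels

section Spectral

variable {X : Type*} [NormedAddCommGroup X] [NormedSpace ℂ X] [FiniteDimensional ℂ X]

/-- The peripheral spectrum: the part of the spectrum on the unit circle. -/
def peripheralSpectrum (A : X →L[ℂ] X) : Set ℂ :=
  spectrum ℂ A ∩ Metric.sphere 0 1

/-- The spectral projector of `A` on `{e}`, that is `(2πi)⁻¹ ∮ (z - A)⁻¹ dz` over any circle
around `e` that is small enough to enclose no other point of the spectrum. The integral does not
depend on the radius of such a circle, so the limit is taken of an eventually constant function. -/
def spectralProjector (A : X →L[ℂ] X) (e : ℂ) : X →L[ℂ] X :=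
  limUnder (𝓝[>] (0 : ℝ)) fun r : ℝ =>
    (2 * Real.pi * Complex.I : ℂ)⁻¹ • ∮ z in C(e, r), resolvent A z

/-- The peripheral spectral projector: the sum of the spectral projectors over the (finitely many)
peripheral eigenvalues. -/
def peripheralProjector (A : X →L[ℂ] X) : X →L[ℂ] X :=
  ∑ᶠ e ∈ peripheralSpectrum A, spectralProjector A e

/-- The peripheral part of `A`. -/
def peripheralPart (A : X →L[ℂ] X) : X →L[ℂ] X :=
  A * peripheralProjector A

/-- The complementary, strictly contracting part of `A`. -/
def nonperipheralPart (A : X →L[ℂ] X) : X →L[ℂ] X :=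
  A * (1 - peripheralProjector A)

/-- The eigenvalue `e` of `A` is simple: its algebraic multiplicity is one. -/
def IsSimpleEigenvalue (A : X →L[ℂ] X) (e : ℂ) : Prop :=
  Module.finrank ℂ (Module.End.maxGenEigenspace A.toLinearMap e) = 1

/-- `C²` on `[0,1]` (with one-sided derivatives at the end points; equivalently, continuous on
`[0,1]`, `C²` on `(0,1)`, the first two derivatives having limits at `0` and `1`). -/
def IsC2 {E : Type*} [NormedAddCommGroup E] [NormedSpace ℝ E] (f : ℝ → E) : Prop :=
  ContDiffOn ℝ 2 f (Icc 0 1)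

/-- Every `L(s)` is a contraction. -/
def IsContractive (L : ℝ → X →L[ℂ] X) : Prop :=
  ∀ s ∈ Icc (0 : ℝ) 1, ‖L s‖ ≤ 1

/-- The peripheral eigenvalues are simple, with a gap between them that is uniform in `s`. -/
def HasPeripheralGap (L : ℝ → X →L[ℂ] X) : Prop :=
  ∃ ε : ℝ, 0 < ε ∧ ∀ s ∈ Icc (0 : ℝ) 1,
    (∀ e ∈ peripheralSpectrum (L s), IsSimpleEigenvalue (L s) e) ∧
    ∀ e ∈ peripheralSpectrum (L s), ∀ e' ∈ peripheralSpectrum (L s), e ≠ e' → 2 * ε < ‖e - e'‖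

/-- The peripheral part of `L(s)` is a `C²` function of `s`. -/
def HasC2PeripheralPart (L : ℝ → X →L[ℂ] X) : Prop :=
  IsC2 fun s => peripheralPart (L s)

/-- The supremum over `s` of the norms of the strictly contracting parts, in `[0,∞]`. -/
def nonperipheralNorm (L : ℝ → X →L[ℂ] X) : ENNReal :=
  ⨆ s ∈ Icc (0 : ℝ) 1, ‖nonperipheralPart (L s)‖ₑ

/-- The supremum over `s` of the spectral radii of the strictly contracting parts, in `[0,∞]`. -/
def nonperipheralSpectralRadius (L : ℝ → X →L[ℂ] X) : ENNReal :=
  ⨆ s ∈ Icc (0 : ℝ) 1, spectralRadius ℂ (nonperipheralPart (L s))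

/-- The uniform norm bound on the strictly contracting part. -/
def HasNormBound (L : ℝ → X →L[ℂ] X) : Prop :=
  nonperipheralNorm L < 1

/-- The uniform spectral bound on the strictly contracting part. -/
def HasSpectralBound (L : ℝ → X →L[ℂ] X) : Prop :=
  nonperipheralSpectralRadius L < 1

/-- The four standing conditions of the adiabatic theory together. -/
def IsAdiabatic (L : ℝ → X →L[ℂ] X) : Prop :=
  IsContractive L ∧ HasPeripheralGap L ∧ HasC2PeripheralPart L ∧ HasNormBound L

end Spectral

/-- The set `S_z` of the `z`-th roots of unity. -/
def unitRoots (z : ℕ) : Set ℂ :=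
  {w | ∃ k : ℕ, k < z ∧ w = Complex.exp (2 * Complex.I * Real.pi * k / z)}

end

noncomputable section

/-! ### Eigenpairs: left and right eigenvectors, resolvent and spectral projector -/

section EigenPair

variable {X : Type*} [NormedAddCommGroup X] [NormedSpace ℂ X]

/-! The core is algebraic. A CPTP map `Φ` has Kraus operators `K i`, and under the trace pairing a
left eigenvector of `Φ` with unimodular eigenvalue `e` is an operator `u` with `krausDual K u = e •
u`. Equality in Cauchy-Schwarz on the vectors where `u` attains its norm, together with
irreducibility, forces `u * K i = e • (K i * u)` (`intertwines_of_krausDual_eq`). Irreducibility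
also says that the `K i` have no common invariant subspace, so by Schur's lemma a nonzero
intertwiner is invertible and unique up to scalars. Intertwiners multiply, hence the peripheral
spectrum is a finite multiplicatively closed set of nonzero numbers, that is, all `z`-th roots of
unity with `z ≤ dim X`. Left eigenvectors being unique and `Φ` a contraction, each peripheral
eigenvalue is simple and its contour integral is a rank one projector.

Next, the peripheral spectrum does not depend on `s`. It stays in the finite set of `(dim X)!`-th
roots of unity, and H4 or wH4 keeps the other eigenvalues in a fixed disk of radius less than one.
So, for `e` in some peripheral spectrum, the continuous function `|det (e - L s)|` is either zero or
bounded below, and cannot change from one to the other on an interval. A constant peripheral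
spectrum gives H2 at once, and H3 because each projector is locally a smooth expression in `L s`.

For wH4, the power `m` is taken congruent to one modulo `z`. Then `e ^ m = e` for every peripheral
`e`, so projectors and peripheral parts are unchanged, while the nonperipheral part is raised to the
power `m`. Its norm tends to zero pointwise by Gelfand's formula, and uniformly by Dini's theorem,
since contractivity makes the norms decrease with the exponent. -/

/-- `f` and `η` are normalised left and right eigenvectors of `A` for the eigenvalue `e`, whose
eigenspace is spanned by `η`. -/
structure IsEigenPair (A : X →L[ℂ] X) (e : ℂ) (f : X →L[ℂ] ℂ) (η : X) : Prop where
  left : ∀ x, f (A x) = e * f x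
  right : A η = e • η
  pairing : f η = 1
  ker_le : ∀ x, A x = e • x → x = f x • η

/-- A Jordan block at a unimodular eigenvalue would make the powers of `A` grow linearly, which a
contraction does not allow. -/
theorem eq_zero_of_shift_eq_eigenvector {A : X →L[ℂ] X} {e : ℂ} (hA : ‖A‖ ≤ 1) (he : ‖e‖ = 1)
    {η y : X} (hη : A η = e • η) (hy : A y = e • y + η) : η = 0 := by
  -- Starting from `e • y` instead of `y` gives the coefficient `n * e ^ n` and avoids the exponent
  -- `n - 1`.
  have hpow : ∀ n : ℕ, (A ^ n) (e • y) = e ^ n • (e • y) + (n * e ^ n) • η := by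
    intro n
    induction n with
    | zero => simp
    | succ k ih =>
      rw [pow_succ', mul_apply_eq_comp, ih]
      simp only [map_add, map_smul, hη, hy]
      push_cast
      module
  have hbound : ∀ n : ℕ, n * ‖η‖ ≤ 2 * ‖e • y‖ := by
    intro n
    have h1 : ‖(A ^ n) (e • y)‖ ≤ ‖e • y‖ := by
      refine ((A ^ n).le_opNorm _).trans ?_
      refine mul_le_of_le_one_left (norm_nonneg _) ?_
      rcases Nat.eq_zero_or_pos n with rfl | hn
      · rw [pow_zero]
        exact ContinuousLinearMap.norm_id_le
      · exact (norm_pow_le' A hn).trans (pow_le_one₀ (norm_nonneg _) hA)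
    have h2 : ‖((n : ℂ) * e ^ n) • η‖ = n * ‖η‖ := by
      rw [norm_smul, norm_mul, norm_pow, he]
      simp
    have h3 : ((n : ℂ) * e ^ n) • η = (A ^ n) (e • y) - e ^ n • (e • y) := by
      rw [hpow]; abel
    rw [← h2, h3]
    refine (norm_sub_le _ _).trans ?_
    rw [norm_smul, norm_pow, he, one_pow, one_mul]
    linarith
  by_contra h
  obtain ⟨n, hn⟩ := exists_nat_gt (2 * ‖e • y‖ / ‖η‖)
  have := (div_lt_iff₀ (norm_pos_iff.2 h)).1 hn
  exact absurd (hbound n) (not_le.2 this)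

namespace IsEigenPair

variable {A : X →L[ℂ] X} {e : ℂ} {f : X →L[ℂ] ℂ} {η : X}

theorem ne_zero (h : IsEigenPair A e f η) : η ≠ 0 := by
  rintro rfl
  simpa using h.pairing

theorem smulRight_mul_self (h : IsEigenPair A e f η) :
    f.smulRight η * f.smulRight η = f.smulRight η := by
  ext x; simp [h.pairing]

theorem mul_smulRight (h : IsEigenPair A e f η) : A * f.smulRight η = e • f.smulRight η := by
  ext x; simp [h.right, smul_smul, mul_comm]

theorem smulRight_mul (h : IsEigenPair A e f η) : f.smulRight η * A = e • f.smulRight η := by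
  ext x; simp [h.left, smul_smul]

theorem commute (h : IsEigenPair A e f η) : Commute A (f.smulRight η) :=
  h.mul_smulRight.trans h.smulRight_mul.symm

/-- `A - e` preserves `ker f` and is injective there, so a generalised eigenvector has no component
in `ker f` beside its multiple of `η`. -/
theorem isSimpleEigenvalue (h : IsEigenPair A e f η) : IsSimpleEigenvalue A e := by
  rw [IsSimpleEigenvalue]
  have hker : ∀ n : ℕ, ∀ x, ((A - e • (1 : X →L[ℂ] X)) ^ n) x = 0 → f x = 0 → x = 0 := by
    intro n
    induction n with
    | zero => intro x hx _; simpa using hx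
    | succ k ih =>
      intro x hx hfx
      rw [pow_succ, mul_apply_eq_comp] at hx
      have h1 := ih _ hx (by simp [h.left])
      have h2 : A x = e • x := by simpa [sub_eq_zero] using h1
      rw [h.ker_le x h2, hfx, zero_smul]
  have hη : ∀ n : ℕ, n ≠ 0 → ((A - e • (1 : X →L[ℂ] X)) ^ n) η = 0 := by
    intro n hn
    obtain ⟨k, rfl⟩ := Nat.exists_eq_succ_of_ne_zero hn
    rw [pow_succ, mul_apply_eq_comp]
    have : (A - e • (1 : X →L[ℂ] X)) η = 0 := by simp [h.right]
    rw [this, map_zero]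
  have hpow : ∀ n : ℕ, (A.toLinearMap - e • (1 : Module.End ℂ X)) ^ n
      = ((A - e • (1 : X →L[ℂ] X)) ^ n).toLinearMap := by
    intro n
    rw [ContinuousLinearMap.toLinearMap_pow]
    rfl
  have hmem : η ∈ Module.End.maxGenEigenspace A.toLinearMap e := by
    rw [Module.End.mem_maxGenEigenspace]
    exact ⟨1, by rw [hpow]; exact hη 1 one_ne_zero⟩
  refine (finrank_eq_one_iff_of_nonzero' (⟨η, hmem⟩ : Module.End.maxGenEigenspace A.toLinearMap e)
    fun h0 => h.ne_zero (congrArg Subtype.val h0)).2 ?_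
  · rintro ⟨x, hx⟩
    obtain ⟨n, hn⟩ := (Module.End.mem_maxGenEigenspace _ _ _).1 hx
    refine ⟨f x, Subtype.ext ?_⟩
    rw [hpow] at hn
    -- The exponent is raised by one because `n` may be zero, and a positive power is needed to kill
    -- `η`.
    have hn' : ((A - e • (1 : X →L[ℂ] X)) ^ (n + 1)) x = 0 := by
      rw [pow_succ', mul_apply_eq_comp]
      erw [hn]
      simp
    have := hker (n + 1) (x - f x • η) (by rw [map_sub, map_smul, hη _ n.succ_ne_zero, hn']; simp)
      (by simp [h.pairing])
    exact (sub_eq_zero.1 this).symm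

/-- Adding the projector moves the eigenvalue `e` to `e + 1` and changes nothing on the complement.
This isolates the pole of the resolvent at `e`. -/
theorem resolvent_eq (h : IsEigenPair A e f η) {z : ℂ} (hz : z ≠ e)
    (hu : z ∈ resolventSet ℂ (A + f.smulRight η)) :
    resolvent A z = (z - e)⁻¹ • f.smulRight η
      + resolvent (A + f.smulRight η) z * (1 - f.smulRight η) := by
  set P := f.smulRight η with hP
  obtain ⟨u, hu⟩ := hu
  have hR : resolvent (A + P) z = ↑u⁻¹ := by rw [resolvent, ← hu, Ring.inverse_unit]
  have hz' : z - e ≠ 0 := sub_ne_zero.2 hz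
  have hPu : Commute P (u : X →L[ℂ] X) := by
    rw [hu]
    exact Commute.sub_right (Algebra.commutes z P).symm (h.commute.symm.add_right (Commute.refl P))
  have hPu' : Commute P (↑u⁻¹ : X →L[ℂ] X) := hPu.units_inv_right
  have hAu' : Commute (algebraMap ℂ (X →L[ℂ] X) z - A) (↑u⁻¹ : X →L[ℂ] X) := by
    refine Commute.units_inv_right ?_
    rw [hu]
    have h1 : Commute A (algebraMap ℂ (X →L[ℂ] X) z) := (Algebra.commutes z A).symm
    refine Commute.sub_left ?_ ?_
    · exact Algebra.commutes _ _
    · exact h1.sub_right ((Commute.refl A).add_right h.commute)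
  have hAP : (algebraMap ℂ (X →L[ℂ] X) z - A) * P = (z - e) • P := by
    rw [sub_mul, h.mul_smulRight, Algebra.algebraMap_eq_smul_one, smul_mul_assoc, one_mul,
      sub_smul]
  have hAQ : (algebraMap ℂ (X →L[ℂ] X) z - A) * (1 - P) = u * (1 - P) := by
    rw [hu]
    have : P * (1 - P) = 0 := by rw [mul_sub, mul_one, h.smulRight_mul_self, sub_self]
    rw [← sub_sub, sub_mul _ P, this, sub_zero]
  have hmul : (algebraMap ℂ (X →L[ℂ] X) z - A) * ((z - e)⁻¹ • P + ↑u⁻¹ * (1 - P)) = 1 := by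
    rw [mul_add, mul_smul_comm, hAP, smul_smul, inv_mul_cancel₀ hz', one_smul, ← mul_assoc,
      hAu'.eq, mul_assoc, hAQ, ← mul_assoc, Units.inv_mul, one_mul]
    abel
  have hcomm : Commute (algebraMap ℂ (X →L[ℂ] X) z - A) ((z - e)⁻¹ • P + ↑u⁻¹ * (1 - P)) := by
    have hAP' : Commute (algebraMap ℂ (X →L[ℂ] X) z - A) P :=
      Commute.sub_left (Algebra.commutes _ _) h.commute
    exact (hAP'.smul_right _).add_right
      (hAu'.mul_right ((Commute.one_right _).sub_right hAP'))
  rw [hR]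
  exact Ring.inverse_unit ⟨_, _, hmul, hcomm.eq.symm.trans hmul⟩

end IsEigenPair

variable [FiniteDimensional ℂ X]

theorem ContinuousLinearMap.isUnit_of_forall_apply_eq_zero (T : X →L[ℂ] X)
    (h : ∀ x, T x = 0 → x = 0) : IsUnit T := by
  have := FiniteDimensional.complete ℂ X
  rw [ContinuousLinearMap.isUnit_iff_isUnit_toLinearMap, LinearMap.isUnit_iff_ker_eq_bot,
    LinearMap.ker_eq_bot']
  exact h

theorem mem_spectrum_iff_exists_eigenvector {A : X →L[ℂ] X} {e : ℂ} :
    e ∈ spectrum ℂ A ↔ ∃ x, x ≠ 0 ∧ A x = e • x := by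
  rw [spectrum.mem_iff, Algebra.algebraMap_eq_smul_one]
  constructor
  · intro h
    by_contra! hx
    refine h (ContinuousLinearMap.isUnit_of_forall_apply_eq_zero _ fun x h0 => ?_)
    by_contra hx0
    refine hx x hx0 ?_
    exact (sub_eq_zero.1 (by simpa using h0)).symm
  · rintro ⟨x, hx, hAx⟩ ⟨u, hu⟩
    refine hx ?_
    have h0 : (u : X →L[ℂ] X) x = 0 := by rw [hu]; simp [hAx]
    have : (↑(u⁻¹) * (u : X →L[ℂ] X)) x = 0 := by
      rw [mul_apply_eq_comp, h0, map_zero]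
    simpa using this

/-- For a contraction, a left eigenvector at a peripheral point that is unique up to scalars can be
completed to a pair. -/
theorem exists_isEigenPair {A : X →L[ℂ] X} {e : ℂ} (hA : ‖A‖ ≤ 1) (he : ‖e‖ = 1)
    {f : X →L[ℂ] ℂ} (hf : f ≠ 0) (hfA : ∀ x, f (A x) = e * f x)
    (huniq : ∀ g : X →L[ℂ] ℂ, (∀ x, g (A x) = e * g x) → ∃ c : ℂ, g = c • f) :
    ∃ (f' : X →L[ℂ] ℂ) (η : X), IsEigenPair A e f' η := by
  -- Were `x` outside the range of `A - e`, a functional vanishing on the range but not at `x` would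
  -- be a left eigenvector, hence a multiple of `f`, which vanishes at `x`. An eigenvector in `ker
  -- f` would therefore start a Jordan block.
  have hrange : ∀ x, f x = 0 → ∃ y, A y = e • y + x := by
    intro x hx
    set p := LinearMap.range (A - e • (1 : X →L[ℂ] X)).toLinearMap with hp
    by_contra! hxy
    have hxp : x ∉ p := by
      rintro ⟨y, hy⟩
      refine hxy y ?_
      have : A y - e • y = x := by simpa using hy
      rw [← this]; abel
    obtain ⟨g, hgx, hgp⟩ := Submodule.exists_le_ker_of_notMem hxp
    obtain ⟨c, hc⟩ := huniq g.toContinuousLinearMap fun y => by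
      have : g ((A - e • (1 : X →L[ℂ] X)) y) = 0 := hgp ⟨y, rfl⟩
      simpa [sub_eq_zero] using this
    have : g x = c * f x := by simpa using congrArg (fun F : X →L[ℂ] ℂ => F x) hc
    exact hgx (by rw [this, hx, mul_zero])
  have hker : ∀ x, A x = e • x → f x = 0 → x = 0 := by
    intro x hx hfx
    obtain ⟨y, hy⟩ := hrange x hfx
    exact eq_zero_of_shift_eq_eigenvector hA he hx hy
  obtain ⟨η, hη0, hη⟩ : ∃ η, η ≠ 0 ∧ A η = e • η := by
    rw [← mem_spectrum_iff_exists_eigenvector, spectrum.mem_iff, Algebra.algebraMap_eq_smul_one]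
    rintro ⟨u, hu⟩
    apply hf
    ext x
    have hx : (u * (↑u⁻¹ : X →L[ℂ] X)) x = x := by simp
    rw [← hx, mul_apply_eq_comp, hu]
    simp [hfA]
  have hfη : f η ≠ 0 := fun h => hη0 (hker η hη h)
  refine ⟨(f η)⁻¹ • f, η, fun x => ?_, hη, ?_, fun x hx => ?_⟩
  · simp [hfA]; ring
  · simp [hfη]
  · have := hker (x - ((f η)⁻¹ * f x) • η) ?_ ?_
    · simpa [sub_eq_zero] using this
    · rw [map_sub, map_smul, hx, hη]; module
    · simp; field_simp; simp

namespace IsEigenPair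

variable {A : X →L[ℂ] X} {e : ℂ} {f : X →L[ℂ] ℂ} {η : X}

theorem isUnit (h : IsEigenPair A e f η) : IsUnit (A - e • 1 + f.smulRight η) := by
  refine ContinuousLinearMap.isUnit_of_forall_apply_eq_zero _ fun x hx => ?_
  have hx' : A x - e • x + f x • η = 0 := by simpa using hx
  have hfx : f x = 0 := by
    have := congrArg f hx'
    simpa [h.left, h.pairing] using this
  rw [hfx, zero_smul, add_zero, sub_eq_zero] at hx'
  rw [h.ker_le x hx', hfx, zero_smul]

/-- Composed with the invertible operator `A - e + f ⊗ η`, both sides become `g η • f`. -/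
theorem left_unique (h : IsEigenPair A e f η) {g : X →L[ℂ] ℂ} (hg : ∀ x, g (A x) = e * g x) :
    g = g η • f := by
  obtain ⟨u, hu⟩ := h.isUnit
  ext x
  have hx : (u * (↑u⁻¹ : X →L[ℂ] X)) x = x := by simp
  rw [← hx, mul_apply_eq_comp, hu]
  simp [hg, h.left, h.pairing, mul_comm]

/-- By `resolvent_eq` the integrand is a simple pole plus a function holomorphic near `e`, whose
integral vanishes by Cauchy's theorem. -/
theorem spectralProjector_eq (h : IsEigenPair A e f η) :
    spectralProjector A e = f.smulRight η := by
  have := FiniteDimensional.complete ℂ X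
  set P := f.smulRight η with hP
  have hopen : IsOpen (resolventSet ℂ (A + P)) := spectrum.isOpen_resolventSet _
  have hmem : e ∈ resolventSet ℂ (A + P) := by
    have h1 := h.isUnit.neg
    have h2 : -(A - e • 1 + P) = algebraMap ℂ (X →L[ℂ] X) e - (A + P) := by
      rw [Algebra.algebraMap_eq_smul_one]; abel
    rw [h2] at h1
    exact h1
  obtain ⟨δ, hδ, hball⟩ := Metric.isOpen_iff.1 hopen e hmem
  refine Tendsto.limUnder_eq ?_
  refine tendsto_const_nhds.congr' ?_
  have : ∀ᶠ r : ℝ in 𝓝[>] 0, r ∈ Ioo 0 δ := Ioo_mem_nhdsGT hδ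
  filter_upwards [this] with r hr
  have hdiff : DifferentiableOn ℂ (fun z => resolvent (A + P) z * (1 - P)) (Metric.ball e δ) := by
    intro z hz
    exact ((spectrum.hasDerivAt_resolvent_const_left (hball hz)).differentiableAt.mul_const
      _).differentiableWithinAt
  have hsub : Metric.closedBall e r ⊆ Metric.ball e δ := Metric.closedBall_subset_ball hr.2
  have hint0 : ∮ z in C(e, r), resolvent (A + P) z * (1 - P) = 0 :=
    Complex.circleIntegral_eq_zero_of_differentiable_on_off_countable hr.1.le countable_empty
      (hdiff.continuousOn.mono hsub) fun z hz =>
        hdiff.differentiableAt (Metric.isOpen_ball.mem_nhds (Metric.ball_subset_ball hr.2.le hz.1))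
  have hcongr : ∮ z in C(e, r), resolvent A z
      = ∮ z in C(e, r), ((z - e)⁻¹ • P + resolvent (A + P) z * (1 - P)) := by
    refine circleIntegral.integral_congr hr.1.le fun z hz => ?_
    refine h.resolvent_eq ?_ (hball (hsub (Metric.sphere_subset_closedBall hz)))
    rintro rfl
    simp [hr.1.ne] at hz
  have hci1 : CircleIntegrable (fun z : ℂ => (z - e)⁻¹ • P) e r := by
    refine ContinuousOn.circleIntegrable hr.1.le ?_
    refine ContinuousOn.smul (f := fun z : ℂ => (z - e)⁻¹) ?_ continuousOn_const
    refine ContinuousOn.inv₀ (by fun_prop) fun z hz => ?_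
    refine sub_ne_zero.2 ?_
    rintro rfl
    simp [hr.1.ne] at hz
  have hci2 : CircleIntegrable (fun z => resolvent (A + P) z * (1 - P)) e r :=
    ContinuousOn.circleIntegrable hr.1.le
      (hdiff.continuousOn.mono (Metric.sphere_subset_closedBall.trans hsub))
  rw [hcongr, circleIntegral.integral_add hci1 hci2, hint0, add_zero,
    circleIntegral.integral_smul_const, circleIntegral.integral_sub_center_inv e hr.1.ne',
    smul_smul, inv_mul_cancel₀ Complex.two_pi_I_ne_zero, one_smul]

/-- An eigenpair of `A` is one of any power of `A` for which `e` is not hit by other eigenvalues. -/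
theorem pow (h : IsEigenPair A e f η) {m : ℕ} (hem : e ^ m = e)
    (hsp : ∀ z ∈ spectrum ℂ A, z ^ m = e → z = e) : IsEigenPair (A ^ m) e f η := by
  have hA : ∀ n : ℕ, (A ^ n) η = e ^ n • η := by
    intro n
    induction n with
    | zero => simp
    | succ k ih => rw [pow_succ, mul_apply_eq_comp, h.right, map_smul, ih,
        smul_smul, pow_succ']
  have hf : ∀ n : ℕ, ∀ x, f ((A ^ n) x) = e ^ n * f x := by
    intro n
    induction n with
    | zero => simp
    | succ k ih =>
      intro x
      rw [pow_succ, mul_apply_eq_comp, ih, h.left]; ring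
  refine ⟨fun x => by rw [hf, hem], by rw [hA, hem], h.pairing, fun x hx => ?_⟩
  by_contra hne
  set y := x - f x • η with hy
  have hy0 : y ≠ 0 := sub_ne_zero.2 hne
  have hfy : f y = 0 := by simp [hy, h.pairing]
  have hAy : (A ^ m) y = e • y := by
    rw [hy, map_sub, map_smul, hA, hx, hem]; module
  -- If `p` is nonzero, then, being `A`-invariant, it contains an eigenvector of `A`. Its eigenvalue
  -- has `m`-th power `e`, so it equals `e`, and the eigenvector would be a multiple of `η` lying in
  -- `ker f`.
  let p : Submodule ℂ X := LinearMap.ker (A ^ m - e • 1).toLinearMap ⊓ LinearMap.ker f.toLinearMap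
  have hmem : ∀ x, x ∈ p ↔ (A ^ m) x = e • x ∧ f x = 0 := by
    intro x
    rw [Submodule.mem_inf, LinearMap.mem_ker, LinearMap.mem_ker]
    refine and_congr ?_ Iff.rfl
    change (A ^ m) x - e • x = 0 ↔ _
    rw [sub_eq_zero]
  have hinv : ∀ x ∈ p, A x ∈ p := by
    intro x hx
    rw [hmem] at hx ⊢
    constructor
    · rw [← mul_apply_eq_comp, ← pow_succ, pow_succ', mul_apply_eq_comp,
        hx.1, map_smul]
    · rw [h.left, hx.2, mul_zero]
  have : Nontrivial p := ⟨⟨⟨y, (hmem y).2 ⟨hAy, hfy⟩⟩, 0, by simpa using hy0⟩⟩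
  obtain ⟨μ, hμ⟩ := Module.End.exists_eigenvalue (A.toLinearMap.restrict hinv)
  obtain ⟨v, hv⟩ := hμ.exists_hasEigenvector
  have hv0 : (v : X) ≠ 0 := by simpa using hv.2
  have hAv : A v = μ • (v : X) := by
    simpa using congrArg Subtype.val hv.apply_eq_smul
  have hAvn : ∀ n : ℕ, (A ^ n) v = μ ^ n • (v : X) := by
    intro n
    induction n with
    | zero => simp
    | succ k ih => rw [pow_succ, mul_apply_eq_comp, hAv, map_smul, ih,
        smul_smul, pow_succ']
  have hvp := (hmem v).1 v.2
  have hμe : μ = e := by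
    refine hsp μ (mem_spectrum_iff_exists_eigenvector.2 ⟨v, hv0, hAv⟩) ?_
    have := (hAvn m).symm.trans hvp.1
    exact smul_left_injective ℂ hv0 this
  rw [hμe] at hAv
  exact hv0 (by rw [h.ker_le v hAv, hvp.2, zero_smul])

end IsEigenPair

end EigenPair

/-! ### Peripheral spectrum, peripheral projector and the complementary part -/

section Peripheral

variable {X : Type*} [NormedAddCommGroup X] [NormedSpace ℂ X]

theorem norm_eq_one_of_mem_peripheralSpectrum {A : X →L[ℂ] X} {e : ℂ}
    (he : e ∈ peripheralSpectrum A) : ‖e‖ = 1 := by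
  simpa using he.2

theorem peripheralSpectrum_pow {A : X →L[ℂ] X} {m : ℕ} (hm : m ≠ 0) (hA : ∀ e ∈ peripheralSpectrum A, e ^ m = e) :
    peripheralSpectrum (A ^ m) = peripheralSpectrum A := by
  ext e
  rw [peripheralSpectrum, spectrum.map_pow_of_pos _ (Nat.pos_of_ne_zero hm)]
  constructor
  · rintro ⟨⟨z, hz, rfl⟩, hz1⟩
    have hz1' : ‖z‖ = 1 := by
      have : ‖z‖ ^ m = 1 := by simpa using hz1
      exact (pow_eq_one_iff_of_nonneg (norm_nonneg _) hm).1 this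
    have hz' : z ∈ peripheralSpectrum A := ⟨hz, by simpa using hz1'⟩
    change z ^ m ∈ _
    rwa [hA z hz']
  · exact fun he => ⟨⟨e, he.1, hA e he⟩, he.2⟩

variable [FiniteDimensional ℂ X]

theorem finite_peripheralSpectrum (A : X →L[ℂ] X) : (peripheralSpectrum A).Finite := by
  have := FiniteDimensional.complete ℂ X
  refine Finite.subset ?_ inter_subset_left
  rw [ContinuousLinearMap.spectrum_eq]
  exact Module.End.finite_spectrum _

/-- Every peripheral eigenvalue of `A` has a normalised pair of left and right eigenvectors. -/
def HasPeripheralEigenPairs (A : X →L[ℂ] X) : Prop :=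
  ∀ e ∈ peripheralSpectrum A, ∃ (f : X →L[ℂ] ℂ) (η : X), IsEigenPair A e f η

theorem peripheralProjector_eq_sum (A : X →L[ℂ] X) :
    peripheralProjector A = ∑ e ∈ (finite_peripheralSpectrum A).toFinset, spectralProjector A e :=
  finsum_mem_eq_finite_toFinset_sum _ _

namespace HasPeripheralEigenPairs

variable {A : X →L[ℂ] X}

theorem mul_spectralProjector (h : HasPeripheralEigenPairs A) {e : ℂ}
    (he : e ∈ peripheralSpectrum A) : A * spectralProjector A e = e • spectralProjector A e := by
  obtain ⟨f, η, hp⟩ := h e he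
  rw [hp.spectralProjector_eq, hp.mul_smulRight]

theorem spectralProjector_mul (h : HasPeripheralEigenPairs A) {e : ℂ}
    (he : e ∈ peripheralSpectrum A) : spectralProjector A e * A = e • spectralProjector A e := by
  obtain ⟨f, η, hp⟩ := h e he
  rw [hp.spectralProjector_eq, hp.smulRight_mul]

theorem spectralProjector_mul_self (h : HasPeripheralEigenPairs A) {e : ℂ}
    (he : e ∈ peripheralSpectrum A) :
    spectralProjector A e * spectralProjector A e = spectralProjector A e := by
  obtain ⟨f, η, hp⟩ := h e he
  rw [hp.spectralProjector_eq, hp.smulRight_mul_self]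

theorem spectralProjector_mul_of_ne (h : HasPeripheralEigenPairs A) {e e' : ℂ}
    (he : e ∈ peripheralSpectrum A) (he' : e' ∈ peripheralSpectrum A) (hne : e ≠ e') :
    spectralProjector A e * spectralProjector A e' = 0 := by
  have h1 : e • (spectralProjector A e * spectralProjector A e')
      = e' • (spectralProjector A e * spectralProjector A e') := by
    rw [← smul_mul_assoc, ← h.spectralProjector_mul he, mul_assoc, h.mul_spectralProjector he',
      mul_smul_comm]
  rw [← sub_eq_zero, ← sub_smul, smul_eq_zero] at h1
  exact h1.resolve_left (sub_ne_zero.2 hne)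

theorem peripheralPart_eq_sum (h : HasPeripheralEigenPairs A) :
    peripheralPart A
      = ∑ e ∈ (finite_peripheralSpectrum A).toFinset, e • spectralProjector A e := by
  rw [peripheralPart, peripheralProjector_eq_sum, Finset.mul_sum]
  exact Finset.sum_congr rfl fun e he => h.mul_spectralProjector (by simpa using he)

theorem commute (h : HasPeripheralEigenPairs A) : Commute A (peripheralProjector A) := by
  rw [peripheralProjector_eq_sum]
  refine Commute.sum_right _ _ _ fun e he => ?_
  have he' : e ∈ peripheralSpectrum A := by simpa using he
  exact (h.mul_spectralProjector he').trans (h.spectralProjector_mul he').symm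

theorem isIdempotentElem (h : HasPeripheralEigenPairs A) :
    IsIdempotentElem (peripheralProjector A) := by
  rw [IsIdempotentElem, peripheralProjector_eq_sum, Finset.sum_mul]
  refine Finset.sum_congr rfl fun e he => ?_
  have he' : e ∈ peripheralSpectrum A := by simpa using he
  rw [Finset.mul_sum, Finset.sum_eq_single e]
  · exact h.spectralProjector_mul_self he'
  · intro e₁ he₁ hne
    exact h.spectralProjector_mul_of_ne he' (by simpa using he₁) hne.symm
  · exact fun hn => absurd he hn

/-- The exponent is positive because the zeroth power is the identity and not the complementary
projector. -/
theorem nonperipheralPart_pow (h : HasPeripheralEigenPairs A) (n : ℕ) :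
    nonperipheralPart A ^ (n + 1) = A ^ (n + 1) * (1 - peripheralProjector A) := by
  have hc : Commute A (1 - peripheralProjector A) := (Commute.one_right _).sub_right h.commute
  rw [nonperipheralPart, hc.mul_pow, h.isIdempotentElem.one_sub.pow_succ_eq]

/-- This monotonicity in the exponent is what makes Dini's theorem applicable. -/
theorem norm_nonperipheralPart_pow_le (h : HasPeripheralEigenPairs A) (hA : ‖A‖ ≤ 1)
    {m n : ℕ} (hmn : m ≤ n) :
    ‖nonperipheralPart A ^ (n + 1)‖ ≤ ‖nonperipheralPart A ^ (m + 1)‖ := by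
  obtain ⟨k, rfl⟩ := Nat.exists_eq_add_of_le hmn
  induction k with
  | zero => exact le_rfl
  | succ k ih =>
    refine le_trans ?_ (ih (by lia))
    have : nonperipheralPart A ^ (m + (k + 1) + 1) = A * nonperipheralPart A ^ (m + k + 1) := by
      rw [← add_assoc, h.nonperipheralPart_pow, h.nonperipheralPart_pow, ← mul_assoc, ← pow_succ']
    rw [this]
    exact (norm_mul_le _ _).trans (mul_le_of_le_one_left (norm_nonneg _) hA)

/-- Peripheral spectral projectors kill eigenvectors for other eigenvalues. Bounds on the
nonperipheral part thus become bounds on the spectrum of `A` off the circle. -/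
theorem mem_spectrum_nonperipheralPart (h : HasPeripheralEigenPairs A) {μ : ℂ}
    (hμ : μ ∈ spectrum ℂ A) (hμ1 : ‖μ‖ ≠ 1) : μ ∈ spectrum ℂ (nonperipheralPart A) := by
  obtain ⟨x, hx, hAx⟩ := mem_spectrum_iff_exists_eigenvector.1 hμ
  refine mem_spectrum_iff_exists_eigenvector.2 ⟨x, hx, ?_⟩
  have hP : peripheralProjector A x = 0 := by
    rw [peripheralProjector_eq_sum, sum_apply]
    refine Finset.sum_eq_zero fun e he => ?_
    have he' : e ∈ peripheralSpectrum A := by simpa using he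
    have h1 : (spectralProjector A e * A) x = (e • spectralProjector A e) x := by
      rw [h.spectralProjector_mul he']
    rw [mul_apply_eq_comp, hAx, map_smul, smul_apply, ← sub_eq_zero,
      ← sub_smul, smul_eq_zero] at h1
    refine h1.resolve_left (sub_ne_zero.2 ?_)
    rintro rfl
    exact hμ1 (norm_eq_one_of_mem_peripheralSpectrum he')
  simp [nonperipheralPart, hP, hAx]

end HasPeripheralEigenPairs

/-! ### Powers that fix every peripheral eigenvalue -/

section Powers

variable {A : X →L[ℂ] X} {m : ℕ}

theorem HasPeripheralEigenPairs.isEigenPair_pow (hm : m ≠ 0)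
    (hA : ∀ e ∈ peripheralSpectrum A, e ^ m = e) {e : ℂ} (he : e ∈ peripheralSpectrum A)
    {f : X →L[ℂ] ℂ} {η : X} (hp : IsEigenPair A e f η) : IsEigenPair (A ^ m) e f η := by
  refine hp.pow (hA e he) fun z hz hze => ?_
  have hz1 : ‖z‖ = 1 := by
    have : ‖z‖ ^ m = 1 := by rw [← norm_pow, hze, norm_eq_one_of_mem_peripheralSpectrum he]
    exact (pow_eq_one_iff_of_nonneg (norm_nonneg _) hm).1 this
  rw [← hze, hA z ⟨hz, by simpa using hz1⟩]

theorem HasPeripheralEigenPairs.pow (h : HasPeripheralEigenPairs A) (hm : m ≠ 0)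
    (hA : ∀ e ∈ peripheralSpectrum A, e ^ m = e) : HasPeripheralEigenPairs (A ^ m) := by
  intro e he
  rw [peripheralSpectrum_pow hm hA] at he
  obtain ⟨f, η, hp⟩ := h e he
  exact ⟨f, η, isEigenPair_pow hm hA he hp⟩

theorem HasPeripheralEigenPairs.peripheralProjector_pow (h : HasPeripheralEigenPairs A)
    (hm : m ≠ 0) (hA : ∀ e ∈ peripheralSpectrum A, e ^ m = e) :
    peripheralProjector (A ^ m) = peripheralProjector A := by
  rw [peripheralProjector, peripheralProjector, peripheralSpectrum_pow hm hA]
  refine finsum_mem_congr rfl fun e he => ?_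
  obtain ⟨f, η, hp⟩ := h e he
  rw [hp.spectralProjector_eq, (isEigenPair_pow hm hA he hp).spectralProjector_eq]

theorem HasPeripheralEigenPairs.peripheralPart_pow (h : HasPeripheralEigenPairs A)
    (hm : m ≠ 0) (hA : ∀ e ∈ peripheralSpectrum A, e ^ m = e) :
    peripheralPart (A ^ m) = peripheralPart A := by
  rw [(h.pow hm hA).peripheralPart_eq_sum, h.peripheralPart_eq_sum]
  refine Finset.sum_congr (by simp only [peripheralSpectrum_pow hm hA]) fun e he => ?_
  have he' : e ∈ peripheralSpectrum A := by simpa using he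
  obtain ⟨f, η, hp⟩ := h e he'
  rw [hp.spectralProjector_eq, (isEigenPair_pow hm hA he' hp).spectralProjector_eq]

theorem HasPeripheralEigenPairs.nonperipheralPart_pow_eq (h : HasPeripheralEigenPairs A)
    (hm : m ≠ 0) (hA : ∀ e ∈ peripheralSpectrum A, e ^ m = e) :
    nonperipheralPart (A ^ m) = nonperipheralPart A ^ m := by
  rw [nonperipheralPart, h.peripheralProjector_pow hm hA]
  obtain ⟨n, rfl⟩ := Nat.exists_eq_succ_of_ne_zero hm
  exact (h.nonperipheralPart_pow n).symm

end Powers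

/-! ### Smooth dependence of the spectral projectors -/

section Smoothness

/-- If `f₀`, `η₀` are fixed and `A - e + f₀ ⊗ η₀` is invertible with inverse `R`, the spectral
projector of `A` at a simple eigenvalue `e` is the normalisation of `(f₀ ∘ R) ⊗ (R η₀)`. -/
theorem IsEigenPair.spectralProjector_eq_of_isUnit {A : X →L[ℂ] X} {e : ℂ} {f f₀ : X →L[ℂ] ℂ}
    {η η₀ : X} (h : IsEigenPair A e f η) (hu : IsUnit (A - e • 1 + f₀.smulRight η₀)) :
    f₀ (Ring.inverse (A - e • 1 + f₀.smulRight η₀)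
      (Ring.inverse (A - e • 1 + f₀.smulRight η₀) η₀)) ≠ 0 ∧
    spectralProjector A e = (f₀ (Ring.inverse (A - e • 1 + f₀.smulRight η₀)
      (Ring.inverse (A - e • 1 + f₀.smulRight η₀) η₀)))⁻¹ •
      (Ring.inverse (A - e • 1 + f₀.smulRight η₀) * f₀.smulRight η₀ *
        Ring.inverse (A - e • 1 + f₀.smulRight η₀)) := by
  obtain ⟨u, hu⟩ := hu
  rw [← hu, Ring.inverse_unit]
  set R : X →L[ℂ] X := ↑u⁻¹ with hR
  have hRT : ∀ x, R ((A - e • 1 + f₀.smulRight η₀) x) = x := fun x => by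
    rw [← hu, ← mul_apply_eq_comp, hR, Units.inv_mul, one_apply_eq_self]
  have hη : η = f₀ η • R η₀ := by
    have h1 := hRT η
    have h2 : (A - e • 1 + f₀.smulRight η₀) η = f₀ η • η₀ := by simp [h.right]
    rw [h2, map_smul] at h1
    exact h1.symm
  have hc : f₀ η ≠ 0 := fun h0 => h.ne_zero (by rw [hη, h0, zero_smul])
  -- `R η₀` is a multiple of `η`, so applying `f₀` determines the scale. This identity is also what
  -- makes `f₀ ∘ R` a left eigenvector.
  have hone : f₀ (R η₀) = 1 := by
    have h1 : f₀ η = f₀ η * f₀ (R η₀) := by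
      conv_lhs => rw [hη]
      simp
    exact mul_left_cancel₀ hc (by rw [← h1, mul_one])
  have hleft : ∀ x, (f₀ ∘L R) (A x) = e * (f₀ ∘L R) x := by
    intro x
    have h1 := congrArg f₀ (hRT x)
    have h2 : (A - e • 1 + f₀.smulRight η₀) x = A x - e • x + f₀ x • η₀ := by simp
    rw [h2] at h1
    simp only [map_add, map_sub, map_smul, hone, smul_eq_mul, mul_one] at h1
    simp only [ContinuousLinearMap.comp_apply]
    linear_combination h1
  have hfR := h.left_unique hleft
  have hRη : R η₀ = (f₀ η)⁻¹ • η := by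
    have h1 : (f₀ η)⁻¹ • η = (f₀ η)⁻¹ • (f₀ η • R η₀) := congrArg _ hη
    rw [h1, smul_smul, inv_mul_cancel₀ hc, one_smul]
  set c : ℂ := (f₀ ∘L R) η with hcdef
  have hf0R : ∀ x, f₀ (R x) = c * f x := fun x => by
    simpa using congrArg (fun F : X →L[ℂ] ℂ => F x) hfR
  have hval : f₀ (R (R η₀)) = c * (f₀ η)⁻¹ := by
    rw [hf0R, hRη]; simp [h.pairing]
  have hc0 : c ≠ 0 := by
    intro h0
    have := hf0R η₀
    rw [hone, h0, zero_mul] at this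
    exact one_ne_zero this
  refine ⟨by rw [hval]; exact mul_ne_zero hc0 (inv_ne_zero hc), ?_⟩
  rw [h.spectralProjector_eq, hval]
  ext x
  simp only [ContinuousLinearMap.smulRight_apply, smul_apply,
    mul_apply_eq_comp, map_smul, hf0R, hRη, smul_smul]
  congr 1
  field_simp

/-- The eigenvectors are frozen at `s₀`. Near `s₀` the projector is then an expression in inverses
of operators affine in `L s`, so no smooth choice of eigenvectors is needed. -/
theorem contDiffOn_spectralProjector {L : ℝ → X →L[ℂ] X} {t : Set ℝ} {n : ℕ}
    (hL : ContDiffOn ℝ n L t) {e : ℂ}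
    (h : ∀ s ∈ t, ∃ (f : X →L[ℂ] ℂ) (η : X), IsEigenPair (L s) e f η) :
    ContDiffOn ℝ n (fun s => spectralProjector (L s) e) t := by
  have := FiniteDimensional.complete ℂ X
  intro s₀ hs₀
  obtain ⟨f₀, η₀, h₀⟩ := h s₀ hs₀
  set T : ℝ → X →L[ℂ] X := fun s => L s - e • 1 + f₀.smulRight η₀ with hT
  have hTd : ContDiffWithinAt ℝ n T t s₀ :=
    ((hL s₀ hs₀).sub contDiffWithinAt_const).add contDiffWithinAt_const
  have hu : IsUnit (T s₀) := h₀.isUnit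
  have hR : ContDiffWithinAt ℝ n (fun s => Ring.inverse (T s)) t s₀ := by
    obtain ⟨u, hu⟩ := hu
    have h1 := contDiffAt_ringInverse (n := (n : WithTop ℕ∞)) ℝ u
    rw [hu] at h1
    exact h1.comp_contDiffWithinAt s₀ hTd
  have hunits : ∀ᶠ s in 𝓝[t] s₀, IsUnit (T s) :=
    hTd.continuousWithinAt.eventually (Units.isOpen.mem_nhds hu)
  let φ : (X →L[ℂ] X) →L[ℝ] ℂ :=
    (f₀ ∘L ContinuousLinearMap.apply ℂ X η₀).restrictScalars ℝ
  have hφ : ContDiffWithinAt ℝ n (fun s => φ (Ring.inverse (T s) * Ring.inverse (T s))) t s₀ :=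
    φ.contDiff.comp_contDiffWithinAt (hR.mul hR)
  have hne : φ (Ring.inverse (T s₀) * Ring.inverse (T s₀)) ≠ 0 :=
    (h₀.spectralProjector_eq_of_isUnit hu).1
  have hG : ContDiffWithinAt ℝ n (fun s => (φ (Ring.inverse (T s) * Ring.inverse (T s)))⁻¹ •
      (Ring.inverse (T s) * f₀.smulRight η₀ * Ring.inverse (T s))) t s₀ :=
    (hφ.inv hne).smul ((hR.mul contDiffWithinAt_const).mul hR)
  have heq : ∀ s ∈ t, IsUnit (T s) → spectralProjector (L s) e
      = (φ (Ring.inverse (T s) * Ring.inverse (T s)))⁻¹ •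
      (Ring.inverse (T s) * f₀.smulRight η₀ * Ring.inverse (T s)) := by
    intro s hs hus
    obtain ⟨f, η, hp⟩ := h s hs
    exact (hp.spectralProjector_eq_of_isUnit hus).2
  refine hG.congr_of_eventuallyEq ?_ (heq s₀ hs₀ hu)
  filter_upwards [hunits, self_mem_nhdsWithin] with s hus hs
  exact heq s hs hus

theorem isC2_peripheralPart {L : ℝ → X →L[ℂ] X} (hL : IsC2 L) {S : Set ℂ}
    (hS : ∀ s ∈ Icc (0 : ℝ) 1, peripheralSpectrum (L s) = S)
    (h : ∀ s ∈ Icc (0 : ℝ) 1, HasPeripheralEigenPairs (L s)) : HasC2PeripheralPart L := by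
  have hfin : S.Finite := by
    rw [← hS 0 (by simp)]
    exact finite_peripheralSpectrum _
  have hsum : ContDiffOn ℝ 2 (fun s => ∑ e ∈ hfin.toFinset, e • spectralProjector (L s) e)
      (Icc 0 1) := by
    refine ContDiffOn.sum fun e he => ContDiffOn.const_smul e ?_
    refine contDiffOn_spectralProjector (n := 2) hL fun s hs => ?_
    refine h s hs e ?_
    rw [hS s hs]
    simpa using he
  refine hsum.congr fun s hs => ?_
  rw [(h s hs).peripheralPart_eq_sum]
  refine Finset.sum_congr ?_ fun _ _ => rfl
  simp only [hS s hs]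

end Smoothness

end Peripheral

/-! ### Trace duality -/

section Trace

variable {H : Type*} [NormedAddCommGroup H] [InnerProductSpace ℂ H]

/-- The trace of an operator. -/
def opTrace : (H →L[ℂ] H) →ₗ[ℂ] ℂ :=
  LinearMap.trace ℂ H ∘ₗ ContinuousLinearMap.coeLM ℂ

theorem opTrace_apply (A : H →L[ℂ] H) : opTrace A = LinearMap.trace ℂ H A.toLinearMap := rfl

theorem opTrace_mul_comm (A B : H →L[ℂ] H) : opTrace (A * B) = opTrace (B * A) :=
  LinearMap.trace_mul_comm ℂ A.toLinearMap B.toLinearMap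

variable [CompleteSpace H] [FiniteDimensional ℂ H]

theorem eq_zero_of_forall_opTrace_mul {W : H →L[ℂ] H} (h : ∀ A, opTrace (W * A) = 0) : W = 0 := by
  obtain ⟨V, -, hV⟩ := exists_contraction_traceNorm W
  have h0 : opTrace (V * W) = 0 := by rw [opTrace_mul_comm, h]
  rw [opTrace_apply] at h0
  rw [h0] at hV
  exact TraceClass.normCore.norm_eq_zero_iff (W : TraceClass H) |>.1 hV

/-- Every functional on the operators is given by the trace pairing. -/
theorem exists_opTrace_eq (g : (H →L[ℂ] H) →ₗ[ℂ] ℂ) :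
    ∃ W : H →L[ℂ] H, ∀ A, g A = opTrace (W * A) := by
  let Ψ : (H →L[ℂ] H) →ₗ[ℂ] Module.Dual ℂ (H →L[ℂ] H) :=
    (LinearMap.mul ℂ (H →L[ℂ] H)).compr₂ opTrace
  have hinj : Function.Injective Ψ := by
    rw [injective_iff_map_eq_zero]
    intro W hW
    exact eq_zero_of_forall_opTrace_mul fun A => LinearMap.congr_fun hW A
  obtain ⟨W, hW⟩ := (LinearMap.injective_iff_surjective_of_finrank_eq_finrank
    (Subspace.dual_finrank_eq).symm).1 hinj g
  exact ⟨W, fun A => (LinearMap.congr_fun hW A).symm⟩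

end Trace

/-! ### Kraus operators and contractivity in the trace norm -/

section Kraus

theorem NonUnitalCStarAlgebra.exists_eq_star_mul_self {B : Type*} [NonUnitalCStarAlgebra B]
    [PartialOrder B] [StarOrderedRing B] {a : B} (h : 0 ≤ a) : ∃ c, a = star c * c :=
  CStarAlgebra.nonneg_iff_eq_star_mul_self.1 h

variable {H : Type*} [NormedAddCommGroup H] [InnerProductSpace ℂ H] [CompleteSpace H]
  {ι : Type*} [Fintype ι]

/-- The operators `K i` are Kraus operators of the channel `Φ`. -/
structure IsKraus [FiniteDimensional ℂ H] (K : ι → H →L[ℂ] H)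
    (Φ : TraceClass H →L[ℂ] TraceClass H) : Prop where
  apply_eq : ∀ A, (Φ A).toOp = ∑ i, K i * A.toOp * star (K i)
  sum_star_mul : ∑ i, star (K i) * K i = 1

open InnerProductSpace in
theorem CompletelyPositiveMap.exists_kraus [FiniteDimensional ℂ H] [Nontrivial H]
    (φ : CompletelyPositiveMap (H →L[ℂ] H) (H →L[ℂ] H)) :
    ∃ K : Fin (Module.finrank ℂ H) × Fin (Module.finrank ℂ H) → H →L[ℂ] H,
      ∀ A, φ A = ∑ i, K i * A * star (K i) := by
  set n := Module.finrank ℂ H with hn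
  let b : OrthonormalBasis (Fin n) ℂ H := stdOrthonormalBasis ℂ H
  let E : Fin n → Fin n → H →L[ℂ] H := fun i j => rankOne ℂ (b i) (b j)
  have hEstar : ∀ i j, star (E i j) = E j i := fun i j => by
    rw [ContinuousLinearMap.star_eq_adjoint]
    exact adjoint_rankOne _ _
  have hEE : ∀ i j k l (A : H →L[ℂ] H), E i j * A * E k l = inner ℂ (b j) (A (b k)) • E i l := by
    intro i j k l A
    ext x
    simp [E, smul_smul, mul_comm]
  have hsum : ∑ i, E i i = 1 := b.sum_rankOne_eq_id
  have hE1 : ∀ i j l, E i j * E j l = E i l := by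
    intro i j l
    have := hEE i j j l 1
    simpa using this
  have hA : ∀ A : H →L[ℂ] H, A = ∑ i, ∑ j, inner ℂ (b i) (A (b j)) • E i j := by
    intro A
    calc A = (∑ i, E i i) * A * ∑ j, E j j := by rw [hsum, one_mul, mul_one]
      _ = _ := by
        rw [Finset.sum_mul, Finset.sum_mul_sum]
        simp only [hEE]
  have hpos : 0 < n := Module.finrank_pos
  let i₀ : Fin n := ⟨0, hpos⟩
  -- Choi's argument: the block matrix of matrix units is positive, being `star N * N` with `N`
  -- supported in one row. Complete positivity keeps it positive, and a factorisation `star C * C`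
  -- of its image yields the Kraus operators.
  let M : CStarMatrix (Fin n) (Fin n) (H →L[ℂ] H) := CStarMatrix.ofMatrix fun i j => E i j
  let N : CStarMatrix (Fin n) (Fin n) (H →L[ℂ] H) :=
    CStarMatrix.ofMatrix fun k j => if k = i₀ then E i₀ j else 0
  have hM : M = star N * N := by
    ext1 i j
    rw [CStarMatrix.mul_apply, Finset.sum_eq_single i₀]
    · change E i j = star (if i₀ = i₀ then E i₀ i else 0) * (if i₀ = i₀ then E i₀ j else 0)
      rw [if_pos rfl, if_pos rfl, hEstar, hE1]
    · intro k _ hk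
      change _ * (if k = i₀ then E i₀ j else 0) = 0
      rw [if_neg hk, mul_zero]
    · simp
  have hM0 : 0 ≤ M := by rw [hM]; exact star_mul_self_nonneg N
  obtain ⟨C, hC⟩ := NonUnitalCStarAlgebra.exists_eq_star_mul_self
    (φ.map_cstarMatrix_nonneg' n M hM0)
  have hφE : ∀ i j, φ (E i j) = ∑ k, star (C k i) * C k j := by
    intro i j
    have h1 : (M.map φ.toLinearMap) i j = (star C * C) i j := by rw [hC]
    rw [CStarMatrix.mul_apply] at h1
    exact h1
  -- The entries of `C` are themselves operators. The second index `l` runs over the basis, and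
  -- summing over it inserts the resolution of the identity `∑ E l l = 1`.
  let K : Fin n × Fin n → H →L[ℂ] H := fun p => ∑ i, star (C p.1 i) * E p.2 i
  have hKstar : ∀ p, star (K p) = ∑ j, E j p.2 * C p.1 j := by
    intro p
    simp [K, star_sum, hEstar]
  refine ⟨K, fun A => ?_⟩
  have hterm : ∀ p : Fin n × Fin n, K p * A * star (K p)
      = ∑ i, ∑ j, inner ℂ (b i) (A (b j)) • (star (C p.1 i) * E p.2 p.2 * C p.1 j) := by
    intro p
    rw [hKstar, Finset.sum_mul, Finset.sum_mul_sum]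
    refine Finset.sum_congr rfl fun i _ => Finset.sum_congr rfl fun j _ => ?_
    calc star (C p.1 i) * E p.2 i * A * (E j p.2 * C p.1 j)
        = star (C p.1 i) * (E p.2 i * A * E j p.2) * C p.1 j := by simp only [mul_assoc]
      _ = _ := by rw [hEE, mul_smul_comm, smul_mul_assoc]
  rw [Fintype.sum_prod_type]
  simp only [hterm]
  have hl : ∀ k, ∑ l, ∑ i, ∑ j, inner ℂ (b i) (A (b j)) • (star (C k i) * E l l * C k j)
      = ∑ i, ∑ j, inner ℂ (b i) (A (b j)) • (star (C k i) * C k j) := by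
    intro k
    rw [Finset.sum_comm]
    refine Finset.sum_congr rfl fun i _ => ?_
    rw [Finset.sum_comm]
    refine Finset.sum_congr rfl fun j _ => ?_
    rw [← Finset.smul_sum, ← Finset.sum_mul, ← Finset.mul_sum, hsum, mul_one]
  simp only [hl]
  rw [Finset.sum_comm]
  conv_lhs => rw [hA A]
  rw [map_sum]
  refine Finset.sum_congr rfl fun i _ => ?_
  rw [Finset.sum_comm, map_sum]
  refine Finset.sum_congr rfl fun j _ => ?_
  rw [map_smul, hφE, Finset.smul_sum]

theorem IsCPTP.exists_isKraus [FiniteDimensional ℂ H] [Nontrivial H]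
    {Φ : TraceClass H →L[ℂ] TraceClass H} (h : IsCPTP Φ) :
    ∃ K : Fin (Module.finrank ℂ H) × Fin (Module.finrank ℂ H) → H →L[ℂ] H, IsKraus K Φ := by
  obtain ⟨⟨φ, hφ⟩, htr⟩ := h
  obtain ⟨K, hK⟩ := φ.exists_kraus
  refine ⟨K, fun A => by rw [hφ, hK], ?_⟩
  rw [← sub_eq_zero]
  refine eq_zero_of_forall_opTrace_mul fun A => ?_
  have h1 : opTrace (∑ i, K i * A * star (K i)) = opTrace A := by
    rw [← hK]
    have h2 := htr (TraceClass.toOp.symm A)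
    rw [hφ] at h2
    exact h2
  rw [sub_mul, one_mul, map_sub, sub_eq_zero, ← h1, Finset.sum_mul, map_sum, map_sum]
  refine Finset.sum_congr rfl fun i _ => ?_
  rw [mul_assoc, opTrace_mul_comm]

/-- The dual (Heisenberg picture) of the map with Kraus operators `K`. -/
def krausDual (K : ι → H →L[ℂ] H) (W : H →L[ℂ] H) : H →L[ℂ] H :=
  ∑ i, star (K i) * W * K i

theorem inner_krausDual (K : ι → H →L[ℂ] H) (W : H →L[ℂ] H) (x y : H) :
    inner ℂ x (krausDual K W y) = ∑ i, inner ℂ (K i x) (W (K i y)) := by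
  rw [krausDual, sum_apply, inner_sum]
  refine Finset.sum_congr rfl fun i _ => ?_
  change inner ℂ x (star (K i) (W (K i y))) = _
  rw [ContinuousLinearMap.star_eq_adjoint, ContinuousLinearMap.adjoint_inner_right]

theorem sum_norm_sq_of_sum_star_mul {K : ι → H →L[ℂ] H} (h : ∑ i, star (K i) * K i = 1) (x : H) :
    ∑ i, ‖K i x‖ ^ 2 = ‖x‖ ^ 2 := by
  have h1 := inner_krausDual K 1 x x
  have h2 : krausDual K 1 = 1 := by simpa [krausDual] using h
  rw [h2] at h1
  simp only [one_apply_eq_self, inner_self_eq_norm_sq_to_K] at h1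
  exact_mod_cast h1.symm

/-- Cauchy-Schwarz in `H` and then over the index `i`, with `∑ ‖K i x‖ ^ 2 = ‖x‖ ^ 2` from the
normalisation. -/
theorem norm_krausDual_apply_le {K : ι → H →L[ℂ] H} (h : ∑ i, star (K i) * K i = 1)
    {W : H →L[ℂ] H} (hW : ∀ x, ‖W x‖ ≤ ‖x‖) (y : H) : ‖krausDual K W y‖ ≤ ‖y‖ := by
  have key : ∀ x, ‖inner ℂ x (krausDual K W y)‖ ≤ ‖x‖ * ‖y‖ := by
    intro x
    rw [inner_krausDual]
    calc ‖∑ i, inner ℂ (K i x) (W (K i y))‖ ≤ ∑ i, ‖K i x‖ * ‖K i y‖ := by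
          refine (norm_sum_le _ _).trans (Finset.sum_le_sum fun i _ => ?_)
          exact (norm_inner_le_norm _ _).trans (by gcongr; exact hW _)
      _ ≤ √(∑ i, ‖K i x‖ ^ 2) * √(∑ i, ‖K i y‖ ^ 2) := Real.sum_mul_le_sqrt_mul_sqrt _ _ _
      _ = ‖x‖ * ‖y‖ := by
          rw [sum_norm_sq_of_sum_star_mul h, sum_norm_sq_of_sum_star_mul h,
            Real.sqrt_sq (norm_nonneg _), Real.sqrt_sq (norm_nonneg _)]
  set v := krausDual K W y
  have h1 := key v
  rw [inner_self_eq_norm_sq_to_K] at h1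
  have h2 : ‖v‖ * ‖v‖ ≤ ‖v‖ * ‖y‖ := by
    simpa [sq] using h1
  rcases (norm_nonneg v).eq_or_lt with h0 | h0
  · rw [← h0]; exact norm_nonneg _
  · exact le_of_mul_le_mul_left h2 h0

variable [FiniteDimensional ℂ H]

namespace IsKraus

variable {K : ι → H →L[ℂ] H} {Φ : TraceClass H →L[ℂ] TraceClass H}

theorem opTrace_mul_apply (h : IsKraus K Φ) (W : H →L[ℂ] H) (A : TraceClass H) :
    opTrace (W * (Φ A).toOp) = opTrace (krausDual K W * A.toOp) := by
  rw [h.apply_eq, krausDual, Finset.mul_sum, Finset.sum_mul, map_sum, map_sum]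
  refine Finset.sum_congr rfl fun i _ => ?_
  rw [← mul_assoc, opTrace_mul_comm]
  simp only [mul_assoc]

/-- The trace norm is attained by pairing with a contraction, and the dual map sends contractions to
contractions. -/
theorem norm_le_one (h : IsKraus K Φ) : ‖Φ‖ ≤ 1 := by
  refine Φ.opNorm_le_bound zero_le_one fun A => ?_
  obtain ⟨W, hW, ht⟩ := exists_contraction_traceNorm (Φ A).toOp
  rw [TraceClass.norm_def, ht, ← opTrace_apply, h.opTrace_mul_apply, one_mul]
  exact re_trace_mul_le_traceNorm _ _ (norm_krausDual_apply_le h.sum_star_mul hW)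

end IsKraus

end Kraus

section Functionals

variable {X : Type*} [NormedAddCommGroup X] [NormedSpace ℂ X] [FiniteDimensional ℂ X]

theorem mem_spectrum_iff_exists_functional {A : X →L[ℂ] X} {e : ℂ} :
    e ∈ spectrum ℂ A ↔ ∃ g : X →ₗ[ℂ] ℂ, g ≠ 0 ∧ ∀ x, g (A x) = e * g x := by
  have hcomplete := FiniteDimensional.complete ℂ X
  rw [ContinuousLinearMap.spectrum_eq, spectrum.mem_iff, LinearMap.isUnit_iff_range_eq_top]
  constructor
  · intro h
    obtain ⟨x, -, hx⟩ := SetLike.exists_of_lt (lt_top_iff_ne_top.2 h)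
    obtain ⟨g, hgx, hg⟩ := Submodule.exists_le_ker_of_notMem hx
    refine ⟨g, fun h0 => hgx (by rw [h0]; rfl), fun y => ?_⟩
    have : g (e • y - A y) = 0 := hg ⟨y, rfl⟩
    rw [map_sub, map_smul, sub_eq_zero] at this
    exact this.symm
  · rintro ⟨g, hg0, hg⟩ htop
    refine hg0 (LinearMap.ext fun x => ?_)
    obtain ⟨y, hy⟩ := LinearMap.range_eq_top.1 htop x
    have hy' : e • y - A y = x := hy
    rw [← hy', map_sub, map_smul, hg]
    simp

end Functionals

/-! ### Schur's lemma for intertwiners up to a phase -/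

section Intertwiners

variable {H : Type*} [NormedAddCommGroup H] [InnerProductSpace ℂ H]
  {ι : Type*}

/-- The only subspaces invariant under all `K i` are the trivial ones. -/
def HasNoInvariantSubspace (K : ι → H →L[ℂ] H) : Prop :=
  ∀ M : Submodule ℂ H, (∀ i, ∀ x ∈ M, K i x ∈ M) → M = ⊥ ∨ M = ⊤

/-- `u` intertwines the `K i` up to the phase `e`. -/
def Intertwines (K : ι → H →L[ℂ] H) (e : ℂ) (u : H →L[ℂ] H) : Prop :=
  ∀ i, u * K i = e • (K i * u)

namespace Intertwines

variable {K : ι → H →L[ℂ] H} {e e' : ℂ} {u v : H →L[ℂ] H}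

theorem apply (h : Intertwines K e u) (i : ι) (x : H) : u (K i x) = e • K i (u x) :=
  congrArg (fun T : H →L[ℂ] H => T x) (h i)

theorem one : Intertwines K 1 1 := fun i => by simp

theorem mul (hu : Intertwines K e u) (hv : Intertwines K e' v) :
    Intertwines K (e * e') (u * v) := fun i => by
  rw [mul_assoc, hv i, mul_smul_comm, ← mul_assoc, hu i, smul_mul_assoc, smul_smul, mul_assoc,
    mul_comm e]

/-- The kernel of an intertwiner is invariant under every `K i`. -/
theorem injective (h : Intertwines K e u) (hK : HasNoInvariantSubspace K) (hu : u ≠ 0) :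
    ∀ x, u x = 0 → x = 0 := by
  rcases hK (LinearMap.ker u.toLinearMap) (fun i x hx => by
    have hx' : u x = 0 := hx
    change u (K i x) = 0
    rw [h.apply, hx', map_zero, smul_zero]) with h0 | h0
  · exact LinearMap.ker_eq_bot'.1 h0
  · refine absurd ?_ hu
    ext x
    have : x ∈ LinearMap.ker u.toLinearMap := by rw [h0]; trivial
    exact this

theorem isUnit [FiniteDimensional ℂ H] (h : Intertwines K e u) (hK : HasNoInvariantSubspace K)
    (hu : u ≠ 0) : IsUnit u :=
  ContinuousLinearMap.isUnit_of_forall_apply_eq_zero u (h.injective hK hu)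

theorem mul_ne_zero [FiniteDimensional ℂ H] (hu : Intertwines K e u)
    (hK : HasNoInvariantSubspace K) (hu0 : u ≠ 0) (hv0 : v ≠ 0) : u * v ≠ 0 := by
  rwa [Ne, (hu.isUnit hK hu0).mul_right_eq_zero]

theorem eq_smul_one [FiniteDimensional ℂ H] [Nontrivial H] (h : Intertwines K 1 u)
    (hK : HasNoInvariantSubspace K) : ∃ c : ℂ, u = c • 1 := by
  obtain ⟨c, hc⟩ := Module.End.exists_eigenvalue u.toLinearMap
  obtain ⟨x, hx⟩ := hc.exists_hasEigenvector
  refine ⟨c, ?_⟩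
  by_contra hne
  have h1 : Intertwines K 1 (u - c • 1) := fun i => by
    rw [sub_mul, mul_sub, h i]; simp
  exact hx.2 (h1.injective hK (sub_ne_zero.2 hne) x (by simpa [sub_eq_zero] using hx.apply_eq_smul))

/-- The phases cancel in `u⁻¹ * v`, which commutes with every `K i` and is therefore a scalar. -/
theorem eq_smul [FiniteDimensional ℂ H] [Nontrivial H] (hu : Intertwines K e u)
    (hv : Intertwines K e v) (hK : HasNoInvariantSubspace K) (hu0 : u ≠ 0) :
    ∃ c : ℂ, v = c • u := by
  obtain ⟨w, rfl⟩ := hu.isUnit hK hu0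
  have h1 : Intertwines K 1 (↑w⁻¹ * v) := fun i => by
    have h2 : (↑w⁻¹ : H →L[ℂ] H) * (w * K i) * ↑w⁻¹ = ↑w⁻¹ * (e • (K i * w)) * ↑w⁻¹ := by
      rw [hu i]
    rw [Units.inv_mul_cancel_left, mul_smul_comm, smul_mul_assoc, mul_assoc, mul_assoc (K i),
      Units.mul_inv, mul_one] at h2
    rw [mul_assoc, hv i, one_smul, ← mul_assoc, h2, mul_smul_comm, smul_mul_assoc, mul_assoc]
  obtain ⟨c, hc⟩ := h1.eq_smul_one hK
  refine ⟨c, ?_⟩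
  have h3 : (w : H →L[ℂ] H) * (↑w⁻¹ * v) = w * (c • 1) := by rw [hc]
  rwa [Units.mul_inv_cancel_left, mul_smul_comm, mul_one] at h3

end Intertwines

theorem exists_norm_apply_eq_opNorm [FiniteDimensional ℂ H] [Nontrivial H] (u : H →L[ℂ] H) :
    ∃ x, x ≠ 0 ∧ ‖u x‖ = ‖u‖ * ‖x‖ := by
  have := FiniteDimensional.proper ℂ H
  obtain ⟨x, hx, hmax⟩ := (isCompact_sphere (0 : H) 1).exists_isMaxOn
    (NormedSpace.sphere_nonempty (E := H).2 zero_le_one)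
    (f := fun x => ‖u x‖) (by fun_prop)
  have hx1 : ‖x‖ = 1 := by simpa using hx
  refine ⟨x, fun h0 => by simp [h0] at hx1, le_antisymm (u.le_opNorm x) ?_⟩
  rw [hx1, mul_one]
  exact ContinuousLinearMap.opNorm_le_of_unit_norm (norm_nonneg _) fun y hy =>
    hmax (by simpa using hy)

variable [CompleteSpace H] [Fintype ι]

theorem Intertwines.krausDual_eq {K : ι → H →L[ℂ] H} (hK : ∑ i, star (K i) * K i = 1) {e : ℂ}
    {u : H →L[ℂ] H} (h : Intertwines K e u) : krausDual K u = e • u := by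
  have : ∀ i, star (K i) * u * K i = e • (star (K i) * K i * u) := fun i => by
    rw [mul_assoc, h i, mul_smul_comm, mul_assoc]
  rw [krausDual, Finset.sum_congr rfl fun i _ => this i, ← Finset.smul_sum, ← Finset.sum_mul, hK,
    one_mul]

/-- The vectors on which `u` attains its norm are thus the kernel of a linear map, hence a subspace.
-/
theorem norm_apply_eq_iff_star_mul_apply_eq (u : H →L[ℂ] H) (x : H) :
    ‖u x‖ = ‖u‖ * ‖x‖ ↔ (star u * u) x = (‖u‖ ^ 2 : ℂ) • x := by
  have hin : inner ℂ x ((star u * u) x) = (‖u x‖ : ℂ) ^ 2 := by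
    rw [mul_apply_eq_comp, ContinuousLinearMap.star_eq_adjoint,
      ContinuousLinearMap.adjoint_inner_right, inner_self_eq_norm_sq_to_K]
    rfl
  constructor
  · intro h
    have h1 : ‖(star u * u) x‖ ≤ ‖u‖ ^ 2 * ‖x‖ := by
      have := (star u).le_opNorm (u x)
      rw [norm_star, h] at this
      calc ‖(star u * u) x‖ ≤ ‖u‖ * (‖u‖ * ‖x‖) := this
        _ = _ := by ring
    rw [← sub_eq_zero, ← norm_eq_zero, ← sq_eq_zero_iff]
    refine le_antisymm ?_ (sq_nonneg _)
    rw [@norm_sub_sq ℂ, inner_smul_right, ← inner_conj_symm, hin, h, norm_smul]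
    have h2 : RCLike.re ((‖u‖ : ℂ) ^ 2 * (starRingEnd ℂ) (((‖u‖ * ‖x‖ : ℝ) : ℂ) ^ 2))
        = ‖u‖ ^ 2 * (‖u‖ * ‖x‖) ^ 2 := by
      rw [← Complex.ofReal_pow, ← Complex.ofReal_pow, Complex.conj_ofReal, ← Complex.ofReal_mul]
      exact Complex.ofReal_re _
    have h3 : ‖(‖u‖ : ℂ) ^ 2‖ = ‖u‖ ^ 2 := by simp
    rw [h2, h3]
    have h4 := pow_le_pow_left₀ (norm_nonneg _) h1 2
    nlinarith
  · intro h
    rw [h, inner_smul_right, inner_self_eq_norm_sq_to_K] at hin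
    have h1 : ‖u‖ ^ 2 * ‖x‖ ^ 2 = ‖u x‖ ^ 2 := Complex.ofReal_injective (by simpa using hin)
    rw [← mul_pow] at h1
    exact ((pow_left_inj₀ (by positivity) (norm_nonneg _) two_ne_zero).1 h1).symm

/-- Peripheral eigenvectors of an irreducible unital completely positive map intertwine its Kraus
operators: the vectors on which `u` attains its norm form an invariant subspace, by the equality
case of the Cauchy-Schwarz inequality. -/
theorem intertwines_of_krausDual_eq [FiniteDimensional ℂ H] [Nontrivial H] {K : ι → H →L[ℂ] H}
    (hK : ∑ i, star (K i) * K i = 1) (hirr : HasNoInvariantSubspace K) {e : ℂ} (he : ‖e‖ = 1)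
    {u : H →L[ℂ] H} (hu : krausDual K u = e • u) : Intertwines K e u := by
  have key : ∀ x, ‖u x‖ = ‖u‖ * ‖x‖ →
      (∀ i, u (K i x) = e • K i (u x)) ∧ ∀ i, ‖u (K i x)‖ = ‖u‖ * ‖K i x‖ := by
    intro x hx
    have hcross : ∑ i, inner ℂ (K i (u x)) (u (K i x)) = e * (‖u x‖ : ℂ) ^ 2 := by
      rw [← inner_krausDual, hu, smul_apply, inner_smul_right, inner_self_eq_norm_sq_to_K]
      rfl
    have hle : ∀ i, ‖u (K i x)‖ ^ 2 ≤ ‖u‖ ^ 2 * ‖K i x‖ ^ 2 := fun i => by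
      rw [← mul_pow]
      exact pow_le_pow_left₀ (norm_nonneg _) (u.le_opNorm _) 2
    have hsq : ∑ i, ‖u‖ ^ 2 * ‖K i x‖ ^ 2 = ‖u x‖ ^ 2 := by
      rw [← Finset.mul_sum, sum_norm_sq_of_sum_star_mul hK, hx, mul_pow]
    have hexp : ∀ i, ‖u (K i x) - e • K i (u x)‖ ^ 2 = ‖u (K i x)‖ ^ 2
        - 2 * (starRingEnd ℂ e * inner ℂ (K i (u x)) (u (K i x))).re + ‖K i (u x)‖ ^ 2 := by
      intro i
      rw [norm_sub_rev, @norm_sub_sq ℂ, inner_smul_left, norm_smul, he, one_mul]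
      change _ - 2 * (starRingEnd ℂ e * inner ℂ (K i (u x)) (u (K i x))).re + _ = _
      ring
    have hre : ∑ i, (starRingEnd ℂ e * inner ℂ (K i (u x)) (u (K i x))).re = ‖u x‖ ^ 2 := by
      rw [← Complex.re_sum, ← Finset.mul_sum, hcross, ← mul_assoc, Complex.conj_mul', he]
      rw [Complex.ofReal_one, one_pow, one_mul, ← Complex.ofReal_pow, Complex.ofReal_re]
    have hsum : ∑ i, ‖u (K i x) - e • K i (u x)‖ ^ 2 = ∑ i, ‖u (K i x)‖ ^ 2 - ‖u x‖ ^ 2 := by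
      rw [Finset.sum_congr rfl fun i _ => hexp i, Finset.sum_add_distrib, Finset.sum_sub_distrib,
        ← Finset.mul_sum, hre, sum_norm_sq_of_sum_star_mul hK]
      ring
    -- The sum equals `∑ ‖u (K i x)‖ ^ 2 - ∑ ‖u‖ ^ 2 * ‖K i x‖ ^ 2`, a difference that is
    -- nonpositive term by term. Its vanishing gives both the intertwining relation at `x` and norm
    -- attainment at each `K i x`.
    have hsum0 : ∑ i, ‖u (K i x) - e • K i (u x)‖ ^ 2 = 0 := by
      refine le_antisymm ?_ (Finset.sum_nonneg fun i _ => sq_nonneg _)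
      rw [hsum, ← hsq]
      exact sub_nonpos.2 (Finset.sum_le_sum fun i _ => hle i)
    have h1 : ∀ i, u (K i x) = e • K i (u x) := by
      intro i
      have := (Finset.sum_eq_zero_iff_of_nonneg fun i _ => sq_nonneg _).1 hsum0 i
        (Finset.mem_univ i)
      rwa [sq_eq_zero_iff, norm_eq_zero, sub_eq_zero] at this
    refine ⟨h1, fun i => ?_⟩
    have h2 : ∑ i, ‖u (K i x)‖ ^ 2 = ∑ i, ‖u‖ ^ 2 * ‖K i x‖ ^ 2 := by
      rw [hsq]; linarith
    have h3 := (Finset.sum_eq_sum_iff_of_le fun i _ => hle i).1 h2 i (Finset.mem_univ i)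
    rw [← mul_pow] at h3
    exact (pow_left_inj₀ (norm_nonneg _) (by positivity) two_ne_zero).1 h3
  let M : Submodule ℂ H := LinearMap.ker (star u * u - (‖u‖ ^ 2 : ℂ) • 1).toLinearMap
  have hM : ∀ x, x ∈ M ↔ ‖u x‖ = ‖u‖ * ‖x‖ := by
    intro x
    rw [norm_apply_eq_iff_star_mul_apply_eq, ← sub_eq_zero]
    rfl
  have htop : M = ⊤ := by
    refine (hirr M fun i x hx => ?_).resolve_left fun hbot => ?_
    · rw [hM] at hx ⊢
      exact (key x hx).2 i
    · obtain ⟨x, hx0, hx⟩ := exists_norm_apply_eq_opNorm u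
      rw [← hM, hbot] at hx
      exact hx0 hx
  intro i
  ext x
  have hx : x ∈ M := by rw [htop]; trivial
  exact (key x ((hM x).1 hx)).1 i

end Intertwiners

/-! ### The peripheral spectrum of an irreducible channel -/

section Irreducible

variable {H : Type*} [NormedAddCommGroup H] [InnerProductSpace ℂ H] [CompleteSpace H]
  [FiniteDimensional ℂ H] {ι : Type*} [Fintype ι] {K : ι → H →L[ℂ] H}
  {Φ : TraceClass H →L[ℂ] TraceClass H}

namespace IsKraus

/-- If `p` projects onto an invariant subspace, then `K i * p = p * K i * p`, so `Φ` preserves the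
corner cut out by `p`. -/
theorem hasNoInvariantSubspace (h : IsKraus K Φ) (hirr : IsIrreducibleMap Φ) :
    HasNoInvariantSubspace K := by
  intro M hM
  set p := M.starProjection with hp
  have hpp : IsStarProjection p := isStarProjection_starProjection
  have hKp : ∀ i, p * K i * p = K i * p := by
    intro i
    ext x
    exact Submodule.starProjection_eq_self_iff.2 (hM i _ (Submodule.starProjection_apply_mem M x))
  have hpK : ∀ i, p * star (K i) * p = p * star (K i) := by
    intro i
    have := congrArg star (hKp i)
    simpa [hpp.isSelfAdjoint.star_eq, mul_assoc] using this
  have hinv : ∀ A : H →L[ℂ] H, ∃ B : H →L[ℂ] H,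
      (Φ (TraceClass.toOp.symm (p * A * p))).toOp = p * B * p := by
    intro A
    refine ⟨(Φ (TraceClass.toOp.symm (p * A * p))).toOp, ?_⟩
    rw [h.apply_eq, LinearEquiv.apply_symm_apply, Finset.mul_sum, Finset.sum_mul]
    refine Finset.sum_congr rfl fun i _ => ?_
    calc K i * (p * A * p) * star (K i) = (K i * p) * A * (p * star (K i)) := by
          simp only [mul_assoc]
      _ = (p * K i * p) * A * (p * star (K i) * p) := by rw [hKp, hpK]
      _ = _ := by simp only [mul_assoc]
  rcases hirr p hpp hinv with h0 | h1
  · left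
    rw [eq_bot_iff]
    intro x hx
    have := Submodule.starProjection_eq_self_iff.2 hx
    rw [← hp, h0] at this
    exact this.symm
  · right
    rw [eq_top_iff]
    intro x _
    refine Submodule.starProjection_eq_self_iff.1 ?_
    rw [← hp, h1]
    rfl

variable [Nontrivial H]

theorem exists_intertwines_of_functional (h : IsKraus K Φ) (hirr : IsIrreducibleMap Φ) {e : ℂ}
    (he : ‖e‖ = 1) {g : TraceClass H →ₗ[ℂ] ℂ} (hg : ∀ A, g (Φ A) = e * g A) :
    ∃ u : H →L[ℂ] H, Intertwines K e u ∧ ∀ A : TraceClass H, g A = opTrace (u * A.toOp) := by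
  obtain ⟨u, hu⟩ := exists_opTrace_eq (g ∘ₗ TraceClass.toOp.symm.toLinearMap)
  have hu' : ∀ A : TraceClass H, g A = opTrace (u * A.toOp) := fun A => hu A.toOp
  refine ⟨u, intertwines_of_krausDual_eq h.sum_star_mul (h.hasNoInvariantSubspace hirr) he ?_, hu'⟩
  rw [← sub_eq_zero]
  refine eq_zero_of_forall_opTrace_mul fun A => ?_
  have h1 := hg (TraceClass.toOp.symm A)
  rw [hu', hu', h.opTrace_mul_apply, LinearEquiv.apply_symm_apply] at h1
  rw [sub_mul, smul_mul_assoc, map_sub, map_smul, h1, smul_eq_mul, sub_self]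

/-- The spectrum is read off from left eigenvectors, because these are the eigenoperators of the
unital dual map. -/
theorem mem_peripheralSpectrum_iff (h : IsKraus K Φ) (hirr : IsIrreducibleMap Φ) {e : ℂ} :
    e ∈ peripheralSpectrum Φ ↔ ‖e‖ = 1 ∧ ∃ u, u ≠ 0 ∧ Intertwines K e u := by
  rw [peripheralSpectrum, mem_inter_iff, mem_spectrum_iff_exists_functional, and_comm,
    mem_sphere_zero_iff_norm]
  refine and_congr_right fun he => ⟨?_, ?_⟩
  · rintro ⟨g, hg0, hg⟩
    obtain ⟨u, hu, hgu⟩ := h.exists_intertwines_of_functional hirr he hg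
    refine ⟨u, ?_, hu⟩
    rintro rfl
    exact hg0 (LinearMap.ext fun A => by rw [hgu, zero_mul, map_zero]; rfl)
  · rintro ⟨u, hu0, hu⟩
    refine ⟨opTrace ∘ₗ LinearMap.mulLeft ℂ u ∘ₗ TraceClass.toOp.toLinearMap, fun h0 => hu0 ?_,
      fun A => ?_⟩
    · exact eq_zero_of_forall_opTrace_mul fun A => LinearMap.congr_fun h0 (TraceClass.toOp.symm A)
    · change opTrace (u * (Φ A).toOp) = e * opTrace (u * A.toOp)
      rw [h.opTrace_mul_apply, hu.krausDual_eq h.sum_star_mul, smul_mul_assoc, map_smul,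
        smul_eq_mul]

theorem hasPeripheralEigenPairs (h : IsKraus K Φ) (hirr : IsIrreducibleMap Φ) :
    HasPeripheralEigenPairs Φ := by
  intro e he
  have he1 := norm_eq_one_of_mem_peripheralSpectrum he
  obtain ⟨f, hf0, hf⟩ := mem_spectrum_iff_exists_functional.1 he.1
  obtain ⟨u, hu, hfu⟩ := h.exists_intertwines_of_functional hirr he1 hf
  have hu0 : u ≠ 0 := by
    rintro rfl
    exact hf0 (LinearMap.ext fun A => by rw [hfu, zero_mul, map_zero]; rfl)
  refine exists_isEigenPair (f := LinearMap.toContinuousLinearMap f) h.norm_le_one he1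
    (by simpa using hf0) hf fun g hg => ?_
  obtain ⟨v, hv, hgv⟩ := h.exists_intertwines_of_functional hirr he1
    (g := g.toLinearMap) hg
  obtain ⟨c, rfl⟩ := hu.eq_smul hv (h.hasNoInvariantSubspace hirr) hu0
  refine ⟨c, ContinuousLinearMap.ext fun A => ?_⟩
  change g.toLinearMap A = c • f A
  rw [hgv, hfu, smul_mul_assoc, map_smul]

theorem one_mem_peripheralSpectrum (h : IsKraus K Φ) (hirr : IsIrreducibleMap Φ) :
    1 ∈ peripheralSpectrum Φ :=
  (h.mem_peripheralSpectrum_iff hirr).2 ⟨norm_one, 1, one_ne_zero, Intertwines.one⟩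

theorem mul_mem_peripheralSpectrum (h : IsKraus K Φ) (hirr : IsIrreducibleMap Φ) {e e' : ℂ}
    (he : e ∈ peripheralSpectrum Φ) (he' : e' ∈ peripheralSpectrum Φ) :
    e * e' ∈ peripheralSpectrum Φ := by
  rw [h.mem_peripheralSpectrum_iff hirr] at *
  obtain ⟨he1, u, hu0, hu⟩ := he
  obtain ⟨he1', v, hv0, hv⟩ := he'
  exact ⟨by rw [norm_mul, he1, he1', one_mul], u * v,
    hu.mul_ne_zero (h.hasNoInvariantSubspace hirr) hu0 hv0, hu.mul hv⟩

end IsKraus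

theorem mem_unitRoots_iff {z : ℕ} (hz : z ≠ 0) {w : ℂ} : w ∈ unitRoots z ↔ w ^ z = 1 := by
  have : NeZero z := ⟨hz⟩
  have hexp : ∀ k : ℕ, 2 * Real.pi * Complex.I * (k / z : ℂ)
      = 2 * Complex.I * Real.pi * k / z := fun k => by ring
  constructor
  · rintro ⟨k, hk, rfl⟩
    rw [← Complex.exp_nat_mul, Complex.exp_eq_one_iff]
    refine ⟨k, ?_⟩
    have : (z : ℂ) ≠ 0 := by exact_mod_cast hz
    push_cast
    field_simp
  · intro h
    have hunit : IsUnit w := IsUnit.of_pow_eq_one h hz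
    obtain ⟨x, rfl⟩ := hunit
    have hx : x ∈ rootsOfUnity z ℂ := by
      rw [_root_.mem_rootsOfUnity]
      exact Units.ext (by simpa using h)
    obtain ⟨k, hk, hkx⟩ := (Complex.mem_rootsOfUnity z x).1 hx
    exact ⟨k, hk, by rw [← hkx, hexp]⟩

/-- A finite set of nonzero complex numbers closed under multiplication is the set of all roots of
unity of order its cardinality. -/
theorem Finset.coe_eq_unitRoots {S : Finset ℂ} (hne : S.Nonempty) (h0 : 0 ∉ S)
    (hmul : ∀ a ∈ S, ∀ b ∈ S, a * b ∈ S) : (S : Set ℂ) = unitRoots S.card := by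
  have hcard : S.card ≠ 0 := hne.card_pos.ne'
  have hpow : ∀ a ∈ S, a ^ S.card = 1 := by
    intro a ha
    have ha0 : a ≠ 0 := fun h => h0 (h ▸ ha)
    have himg : S.image (fun b => a * b) = S := by
      refine Finset.eq_of_subset_of_card_le ?_ ?_
      · intro c hc
        obtain ⟨b, hb, rfl⟩ := Finset.mem_image.1 hc
        exact hmul a ha b hb
      · rw [Finset.card_image_of_injective _ (mul_right_injective₀ ha0)]
    -- Multiplication by `a` permutes `S`; comparing the products over `S` gives `a ^ S.card = 1`.
    have hprod : ∏ b ∈ S, b = a ^ S.card * ∏ b ∈ S, b := by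
      conv_lhs => rw [← himg]
      rw [Finset.prod_image fun b _ c _ h => mul_right_injective₀ ha0 h, Finset.prod_mul_distrib,
        Finset.prod_const]
    have hprod0 : ∏ b ∈ S, b ≠ 0 := Finset.prod_ne_zero_iff.2 fun b hb hb0 => h0 (hb0 ▸ hb)
    exact mul_right_cancel₀ hprod0 (by rw [← hprod, one_mul])
  have hS : S = Polynomial.nthRootsFinset S.card (1 : ℂ) := by
    refine Finset.eq_of_subset_of_card_le ?_ ?_
    · intro a ha
      exact (Polynomial.mem_nthRootsFinset hne.card_pos 1).2 (hpow a ha)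
    · exact (Multiset.toFinset_card_le _).trans (Polynomial.card_nthRoots _ _)
  ext a
  rw [mem_unitRoots_iff hcard, ← Polynomial.mem_nthRootsFinset hne.card_pos, ← hS]
  rfl

theorem IsKraus.peripheralSpectrum_eq_unitRoots [Nontrivial H] (h : IsKraus K Φ)
    (hirr : IsIrreducibleMap Φ) :
    peripheralSpectrum Φ = unitRoots (finite_peripheralSpectrum Φ).toFinset.card := by
  rw [← Finset.coe_eq_unitRoots, Set.Finite.coe_toFinset]
  · exact ⟨1, by simpa using h.one_mem_peripheralSpectrum hirr⟩
  · intro h0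
    simpa using norm_eq_one_of_mem_peripheralSpectrum ((Set.Finite.mem_toFinset _).1 h0)
  · intro a ha b hb
    rw [Set.Finite.mem_toFinset] at *
    exact h.mul_mem_peripheralSpectrum hirr ha hb

end Irreducible

/-! ### Constancy of the peripheral spectrum and Gelfand's formula -/

section Constancy

theorem Set.Finite.exists_pos_forall_le {T : Set ℝ} (hT : T.Finite) (hpos : ∀ t ∈ T, 0 < t) :
    ∃ δ > 0, ∀ t ∈ T, δ ≤ t := by
  rcases T.eq_empty_or_nonempty with rfl | hne
  · exact ⟨1, one_pos, by simp⟩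
  · obtain ⟨a, ha, hmin⟩ := Set.exists_min_image T id hT hne
    exact ⟨a, hpos a ha, hmin⟩

theorem Multiset.pow_card_le_prod_map_of_le {α : Type*} {δ : ℝ} (hδ : 0 ≤ δ) (m : Multiset α)
    (f : α → ℝ) (h : ∀ a ∈ m, δ ≤ f a) : δ ^ m.card ≤ (m.map f).prod := by
  induction m using Multiset.induction_on with
  | empty => simp
  | cons a m ih =>
    rw [Multiset.card_cons, Multiset.map_cons, Multiset.prod_cons, pow_succ']
    exact mul_le_mul (h a (Multiset.mem_cons_self a m))
      (ih fun b hb => h b (Multiset.mem_cons_of_mem hb)) (pow_nonneg hδ _)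
      (hδ.trans (h a (Multiset.mem_cons_self a m)))

variable {X : Type*} [NormedAddCommGroup X] [NormedSpace ℂ X] [FiniteDimensional ℂ X]

theorem mem_spectrum_iff_isRoot_charpoly {A : X →L[ℂ] X} {e : ℂ} :
    e ∈ spectrum ℂ A ↔ A.toLinearMap.charpoly.IsRoot e := by
  have := FiniteDimensional.complete ℂ X
  rw [ContinuousLinearMap.spectrum_eq, ← Module.End.hasEigenvalue_iff_mem_spectrum,
    Module.End.hasEigenvalue_iff_isRoot_charpoly]

theorem card_peripheralSpectrum_le (A : X →L[ℂ] X) :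
    (finite_peripheralSpectrum A).toFinset.card ≤ Module.finrank ℂ X := by
  rw [← LinearMap.charpoly_natDegree A.toLinearMap]
  refine le_trans ?_ (Polynomial.card_roots' _)
  refine le_trans (Finset.card_le_card ?_) (Multiset.toFinset_card_le _)
  intro e he
  rw [Multiset.mem_toFinset, Polynomial.mem_roots A.toLinearMap.charpoly_monic.ne_zero]
  exact mem_spectrum_iff_isRoot_charpoly.1 ((Set.Finite.mem_toFinset _).1 he).1

/-- The determinant is the product of `e - μ` over the `dim X` eigenvalues counted with
multiplicity. -/
theorem pow_finrank_le_norm_det_sub {A : X →L[ℂ] X} {e : ℂ} {δ : ℝ} (hδ : 0 ≤ δ)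
    (h : ∀ μ ∈ spectrum ℂ A, δ ≤ ‖e - μ‖) :
    δ ^ Module.finrank ℂ X ≤ ‖(e • (1 : X →L[ℂ] X) - A).det‖ := by
  have hdet : (e • (1 : X →L[ℂ] X) - A).det = A.toLinearMap.charpoly.eval e := by
    rw [LinearMap.eval_charpoly, Algebra.algebraMap_eq_smul_one]
    rfl
  have hsplit := IsAlgClosed.splits A.toLinearMap.charpoly
  rw [hdet, hsplit.eval_eq_prod_roots, A.toLinearMap.charpoly_monic.leadingCoeff, one_mul,
    ← LinearMap.charpoly_natDegree A.toLinearMap, hsplit.natDegree_eq_card_roots]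
  have hnorm : ∀ m : Multiset ℂ, ‖(m.map fun μ => e - μ).prod‖ = (m.map fun μ => ‖e - μ‖).prod := by
    intro m
    induction m using Multiset.induction_on with
    | empty => simp
    | cons a m ih => simp [ih]
  rw [hnorm]
  refine Multiset.pow_card_le_prod_map_of_le hδ _ _ fun μ hμ => h μ ?_
  exact mem_spectrum_iff_isRoot_charpoly.2 (Polynomial.isRoot_of_mem_roots hμ)

theorem det_sub_eq_zero_of_mem_spectrum {A : X →L[ℂ] X} {e : ℂ} (h : e ∈ spectrum ℂ A) :
    (e • (1 : X →L[ℂ] X) - A).det = 0 := by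
  have := mem_spectrum_iff_isRoot_charpoly.1 h
  rw [Polynomial.IsRoot, LinearMap.eval_charpoly, Algebra.algebraMap_eq_smul_one] at this
  exact this

/-- If the peripheral spectrum stays in a finite set and the rest of the spectrum in a smaller disk,
the peripheral spectrum does not move: `|det (e - L s)|` is continuous and has a gap above `0`. -/
theorem peripheralSpectrum_subset_of_continuousOn {L : ℝ → X →L[ℂ] X}
    {t : Set ℝ} (ht : IsPreconnected t) (hL : ContinuousOn L t) {F : Set ℂ} (hF : F.Finite)
    (hLF : ∀ s ∈ t, peripheralSpectrum (L s) ⊆ F) {r : ℝ} (hr : r < 1)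
    (hLr : ∀ s ∈ t, ∀ μ ∈ spectrum ℂ (L s), ‖μ‖ ≠ 1 → ‖μ‖ ≤ r) {s s' : ℝ} (hs : s ∈ t)
    (hs' : s' ∈ t) : peripheralSpectrum (L s) ⊆ peripheralSpectrum (L s') := by
  intro e he
  have he1 := norm_eq_one_of_mem_peripheralSpectrum he
  refine ⟨?_, he.2⟩
  by_contra hne
  obtain ⟨δ₀, hδ₀, hmin⟩ := ((hF.subset (sdiff_subset (t := {e}))).image
    fun w => ‖e - w‖).exists_pos_forall_le (by
      rintro _ ⟨w, hw, rfl⟩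
      exact norm_pos_iff.2 (sub_ne_zero.2 fun h => hw.2 h.symm))
  -- `δ₀` bounds the distance from `e` to the rest of `F`, and `1 - r` the distance to the disk of
  -- radius `r`.
  set δ := min δ₀ (1 - r) with hδdef
  have hδ : 0 < δ := lt_min hδ₀ (sub_pos.2 hr)
  have hgap : ∀ s ∈ t, e ∉ spectrum ℂ (L s) →
      δ ^ Module.finrank ℂ X ≤ ‖(e • (1 : X →L[ℂ] X) - L s).det‖ := by
    intro s hs hes
    refine pow_finrank_le_norm_det_sub hδ.le fun μ hμ => ?_
    by_cases hμ1 : ‖μ‖ = 1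
    · refine (min_le_left _ _).trans (hmin _ ⟨μ, ⟨hLF s hs ⟨hμ, by simpa using hμ1⟩, ?_⟩, rfl⟩)
      rintro rfl
      exact hes hμ
    · refine (min_le_right _ _).trans ?_
      have h1 := hLr s hs μ hμ hμ1
      have h2 := norm_sub_norm_le e μ
      linarith
  have hcont : ContinuousOn (fun s => ‖(e • (1 : X →L[ℂ] X) - L s).det‖) t :=
    (ContinuousLinearMap.continuous_det.comp_continuousOn (continuousOn_const.sub hL)).norm
  have hη : 0 < δ ^ Module.finrank ℂ X := pow_pos hδ _
  have hzero : ‖(e • (1 : X →L[ℂ] X) - L s).det‖ = 0 := by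
    rw [det_sub_eq_zero_of_mem_spectrum he.1, norm_zero]
  -- Half the gap is a forbidden value: too small if `e` is off the spectrum, nonzero if `e` is on
  -- it.
  obtain ⟨s₁, hs₁, h₁⟩ := ht.intermediate_value hs hs' hcont
    (show δ ^ Module.finrank ℂ X / 2 ∈ _ from ⟨by rw [hzero]; positivity,
      (half_le_self hη.le).trans (hgap s' hs' hne)⟩)
  have h₁' : ‖(e • (1 : X →L[ℂ] X) - L s₁).det‖ = δ ^ Module.finrank ℂ X / 2 := h₁
  by_cases hes : e ∈ spectrum ℂ (L s₁)
  · rw [det_sub_eq_zero_of_mem_spectrum hes, norm_zero] at h₁'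
    linarith
  · have := hgap s₁ hs₁ hes
    linarith

theorem hasPeripheralGap_of_forall_eq {L : ℝ → X →L[ℂ] X} {S : Set ℂ}
    (hS : ∀ s ∈ Icc (0 : ℝ) 1, peripheralSpectrum (L s) = S)
    (h : ∀ s ∈ Icc (0 : ℝ) 1, HasPeripheralEigenPairs (L s)) : HasPeripheralGap L := by
  have hfin : S.Finite := by
    rw [← hS 0 (by simp)]
    exact finite_peripheralSpectrum _
  obtain ⟨δ, hδ, hmin⟩ := (hfin.offDiag.image fun p => ‖p.1 - p.2‖).exists_pos_forall_le (by
    rintro _ ⟨p, hp, rfl⟩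
    exact norm_pos_iff.2 (sub_ne_zero.2 hp.2.2))
  -- Twice `δ / 4` stays strictly below the minimal distance, as the strict inequality requires.
  refine ⟨δ / 4, by positivity, fun s hs => ⟨fun e he => ?_, fun e he e' he' hne => ?_⟩⟩
  · obtain ⟨f, η, hp⟩ := h s hs e he
    exact hp.isSimpleEigenvalue
  · rw [hS s hs] at he he'
    have := hmin _ ⟨(e, e'), ⟨he, he', hne⟩, rfl⟩
    change δ ≤ ‖e - e'‖ at this
    linarith

theorem tendsto_norm_pow_of_spectralRadius_lt_one {A : X →L[ℂ] X} (h : spectralRadius ℂ A < 1) :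
    Tendsto (fun n : ℕ => ‖A ^ n‖) atTop (𝓝 0) := by
  have := FiniteDimensional.complete ℂ X
  obtain ⟨ρ, hρ, hρ1⟩ := exists_between h
  have hev := (spectrum.pow_nnnorm_pow_one_div_tendsto_nhds_spectralRadius A).eventually
    (gt_mem_nhds hρ)
  lift ρ to NNReal using hρ1.ne_top
  have hρ1' : ρ < 1 := by exact_mod_cast hρ1
  refine squeeze_zero' (Eventually.of_forall fun n => norm_nonneg _) ?_
    (tendsto_pow_atTop_nhds_zero_of_lt_one ρ.2 (by exact_mod_cast hρ1'))
  filter_upwards [hev, eventually_ge_atTop 1] with n hn hn1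
  have hn0 : (0 : ℝ) < n := by exact_mod_cast hn1
  have h1 : (‖A ^ n‖₊ : ENNReal) ≤ (ρ : ENNReal) ^ n := by
    rw [← ENNReal.rpow_natCast, ← ENNReal.rpow_inv_le_iff hn0, ← one_div]
    exact hn.le
  have h2 : ‖A ^ n‖₊ ≤ ρ ^ n := by exact_mod_cast h1
  exact_mod_cast h2

end Constancy

/-! ### Families of irreducible channels -/

section Family

variable {H : Type*} [NormedAddCommGroup H] [InnerProductSpace ℂ H] [CompleteSpace H]
  [FiniteDimensional ℂ H] {L : ℝ → TraceClass H →L[ℂ] TraceClass H}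

theorem HasNormBound.exists_norm_le (h : HasNormBound L)
    (hE : ∀ s ∈ Icc (0 : ℝ) 1, HasPeripheralEigenPairs (L s)) :
    ∃ r < 1, ∀ s ∈ Icc (0 : ℝ) 1, ∀ μ ∈ spectrum ℂ (L s), ‖μ‖ ≠ 1 → ‖μ‖ ≤ r := by
  refine ⟨(nonperipheralNorm L).toReal, ?_, fun s hs μ hμ hμ1 => ?_⟩
  · exact (ENNReal.toReal_lt_toReal h.ne_top ENNReal.one_ne_top).2 h
  · obtain ⟨x, hx, hAx⟩ := mem_spectrum_iff_exists_eigenvector.1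
      ((hE s hs).mem_spectrum_nonperipheralPart hμ hμ1)
    have h1 : ‖μ‖ ≤ ‖nonperipheralPart (L s)‖ := by
      have := (nonperipheralPart (L s)).le_opNorm x
      rw [hAx, norm_smul] at this
      exact le_of_mul_le_mul_right this (norm_pos_iff.2 hx)
    refine h1.trans ?_
    rw [← toReal_enorm]
    exact ENNReal.toReal_mono h.ne_top
      (le_iSup₂ (f := fun s (_ : s ∈ Icc (0 : ℝ) 1) => ‖nonperipheralPart (L s)‖ₑ) s hs)

theorem HasSpectralBound.exists_norm_le (h : HasSpectralBound L)
    (hE : ∀ s ∈ Icc (0 : ℝ) 1, HasPeripheralEigenPairs (L s)) :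
    ∃ r < 1, ∀ s ∈ Icc (0 : ℝ) 1, ∀ μ ∈ spectrum ℂ (L s), ‖μ‖ ≠ 1 → ‖μ‖ ≤ r := by
  refine ⟨(nonperipheralSpectralRadius L).toReal, ?_, fun s hs μ hμ hμ1 => ?_⟩
  · exact (ENNReal.toReal_lt_toReal h.ne_top ENNReal.one_ne_top).2 h
  · have h1 : ‖μ‖ₑ ≤ spectralRadius ℂ (nonperipheralPart (L s)) :=
      le_iSup₂ (f := fun k (_ : k ∈ spectrum ℂ (nonperipheralPart (L s))) => (‖k‖₊ : ENNReal)) μ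
        ((hE s hs).mem_spectrum_nonperipheralPart hμ hμ1)
    rw [← toReal_enorm]
    exact ENNReal.toReal_mono h.ne_top (h1.trans
      (le_iSup₂ (f := fun s (_ : s ∈ Icc (0 : ℝ) 1) =>
        spectralRadius ℂ (nonperipheralPart (L s))) s hs))

variable [Nontrivial H]

theorem exists_peripheralSpectrum_eq_unitRoots (hL : ContinuousOn L (Icc 0 1))
    (h : ∀ s ∈ Icc (0 : ℝ) 1, IsCPTP (L s) ∧ IsIrreducibleMap (L s)) {r : ℝ} (hr : r < 1)
    (hLr : ∀ s ∈ Icc (0 : ℝ) 1, ∀ μ ∈ spectrum ℂ (L s), ‖μ‖ ≠ 1 → ‖μ‖ ≤ r) :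
    ∃ z : ℕ, 1 ≤ z ∧ ∀ s ∈ Icc (0 : ℝ) 1, peripheralSpectrum (L s) = unitRoots z := by
  set N := Module.finrank ℂ (TraceClass H)
  have hroots : ∀ s ∈ Icc (0 : ℝ) 1, ∃ z : ℕ, 1 ≤ z ∧ z ≤ N ∧
      peripheralSpectrum (L s) = unitRoots z := by
    intro s hs
    obtain ⟨K, hK⟩ := (h s hs).1.exists_isKraus
    refine ⟨_, ?_, card_peripheralSpectrum_le (L s), hK.peripheralSpectrum_eq_unitRoots (h s hs).2⟩
    exact Finset.card_pos.2 ⟨1, by simpa using hK.one_mem_peripheralSpectrum (h s hs).2⟩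
  have hNfac := N.factorial_pos
  obtain ⟨z, hz1, -, hz⟩ := hroots 0 (by simp)
  have hsub : ∀ s ∈ Icc (0 : ℝ) 1, ∀ s' ∈ Icc (0 : ℝ) 1,
      peripheralSpectrum (L s) ⊆ peripheralSpectrum (L s') := fun s hs s' hs' =>
    peripheralSpectrum_subset_of_continuousOn isPreconnected_Icc hL
      -- Every order `z ≤ N` divides `N!`, so this one finite set contains the peripheral spectra
      -- for all `s`.
      (F := (Polynomial.nthRootsFinset N.factorial (1 : ℂ) : Set ℂ)) (Finset.finite_toSet _)
      (fun s hs e he => by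
        obtain ⟨z, hz1, hzN, hz⟩ := hroots s hs
        rw [hz, mem_unitRoots_iff (by lia)] at he
        obtain ⟨k, hk⟩ := Nat.dvd_factorial hz1 hzN
        rw [Finset.mem_coe, Polynomial.mem_nthRootsFinset hNfac, hk, pow_mul, he, one_pow])
      hr hLr hs hs'
  refine ⟨z, hz1, fun s hs => ?_⟩
  rw [← hz]
  exact (hsub s hs 0 (by simp)).antisymm (hsub 0 (by simp) s hs)

theorem hasPeripheralEigenPairs_of_isCPTP {Φ : TraceClass H →L[ℂ] TraceClass H} (h : IsCPTP Φ)
    (hirr : IsIrreducibleMap Φ) : HasPeripheralEigenPairs Φ := by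
  obtain ⟨K, hK⟩ := h.exists_isKraus
  exact hK.hasPeripheralEigenPairs hirr

theorem IsCPTP.norm_le_one {Φ : TraceClass H →L[ℂ] TraceClass H} (h : IsCPTP Φ) : ‖Φ‖ ≤ 1 := by
  obtain ⟨K, hK⟩ := h.exists_isKraus
  exact hK.norm_le_one

end Family

/-- Dini's theorem upgrades pointwise decay on the compact set `t` to uniform decay. Continuity of
the peripheral part makes the nonperipheral part continuous as well. -/
theorem exists_forall_norm_nonperipheralPart_pow_lt {X : Type*} [NormedAddCommGroup X]
    [NormedSpace ℂ X] [FiniteDimensional ℂ X] {L : ℝ → X →L[ℂ] X} {t : Set ℝ} (ht : IsCompact t)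
    (hL : ContinuousOn L t) (hP : ContinuousOn (fun s => peripheralPart (L s)) t)
    (h1 : ∀ s ∈ t, ‖L s‖ ≤ 1) (hE : ∀ s ∈ t, HasPeripheralEigenPairs (L s))
    (hρ : ∀ s ∈ t, spectralRadius ℂ (nonperipheralPart (L s)) < 1) {ε : ℝ} (hε : 0 < ε) :
    ∃ n₀ : ℕ, ∀ n ≥ n₀, ∀ s ∈ t, ‖nonperipheralPart (L s) ^ (n + 1)‖ < ε := by
  have hN : ContinuousOn (fun s => nonperipheralPart (L s)) t :=
    (hL.sub hP).congr fun s _ => by simp [nonperipheralPart, peripheralPart, mul_sub]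
  have hunif : TendstoUniformlyOn (fun n s => ‖nonperipheralPart (L s) ^ (n + 1)‖)
      (fun _ => (0 : ℝ)) atTop t := by
    refine Antitone.tendstoUniformlyOn_of_forall_tendsto ht (fun n => (hN.pow (n + 1)).norm)
      (fun s hs m n hmn => (hE s hs).norm_nonperipheralPart_pow_le (h1 s hs) hmn)
      continuousOn_const fun s hs => ?_
    exact (tendsto_norm_pow_of_spectralRadius_lt_one (hρ s hs)).comp (tendsto_add_atTop_nat 1)
  obtain ⟨n₀, hn₀⟩ := eventually_atTop.1 (Metric.tendstoUniformlyOn_iff.1 hunif ε hε)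
  refine ⟨n₀, fun n hn s hs => ?_⟩
  simpa using hn₀ n hn s hs

end

theorem proposition6p1 {H : Type*} [NormedAddCommGroup H] [InnerProductSpace ℂ H]
    [CompleteSpace H] [FiniteDimensional ℂ H] [Nontrivial H]
    (L : ℝ → TraceClass H →L[ℂ] TraceClass H) (hC2 : IsC2 L)
    (hL : ∀ s ∈ Set.Icc (0 : ℝ) 1, IsCPTP (L s) ∧ IsIrreducibleMap (L s)) :
    (HasNormBound L → IsAdiabatic L) ∧
    (HasSpectralBound L → ∀ ℓ : ENNReal, nonperipheralSpectralRadius L < ℓ → ℓ < 1 →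
      ∃ m : ℕ, 1 ≤ m ∧ IsAdiabatic (fun s => L s ^ m) ∧
        nonperipheralNorm (fun s => L s ^ m) ≤ ℓ) ∧
    (HasNormBound L ∨ HasSpectralBound L →
      ∃ z : ℕ, 1 ≤ z ∧ ∀ s ∈ Set.Icc (0 : ℝ) 1, peripheralSpectrum (L s) = unitRoots z) := by
  have hcont : ContinuousOn L (Icc 0 1) := ContDiffOn.continuousOn hC2
  have hcontr : IsContractive L := fun s hs => (hL s hs).1.norm_le_one
  have hE : ∀ s ∈ Icc (0 : ℝ) 1, HasPeripheralEigenPairs (L s) := fun s hs =>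
    hasPeripheralEigenPairs_of_isCPTP (hL s hs).1 (hL s hs).2
  have hz : HasNormBound L ∨ HasSpectralBound L →
      ∃ z : ℕ, 1 ≤ z ∧ ∀ s ∈ Set.Icc (0 : ℝ) 1, peripheralSpectrum (L s) = unitRoots z := by
    intro h
    obtain ⟨r, hr, hLr⟩ := h.elim (fun h => h.exists_norm_le hE) fun h => h.exists_norm_le hE
    exact exists_peripheralSpectrum_eq_unitRoots hcont hL hr hLr
  refine ⟨fun h => ?_, fun h ℓ hℓ hℓ1 => ?_, hz⟩
  · obtain ⟨z, -, hzL⟩ := hz (Or.inl h)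
    exact ⟨hcontr, hasPeripheralGap_of_forall_eq hzL hE, isC2_peripheralPart hC2 hzL hE, h⟩
  · obtain ⟨z, hz1, hzL⟩ := hz (Or.inr h)
    have hP := isC2_peripheralPart hC2 hzL hE
    have hε : 0 < ℓ.toReal := ENNReal.toReal_pos (ne_bot_of_gt hℓ) hℓ1.ne_top
    obtain ⟨n₀, hn₀⟩ := exists_forall_norm_nonperipheralPart_pow_lt isCompact_Icc hcont
      (ContDiffOn.continuousOn hP) hcontr hE (fun s hs => lt_of_le_of_lt
        (le_iSup₂ (f := fun s (_ : s ∈ Icc (0 : ℝ) 1) =>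
          spectralRadius ℂ (nonperipheralPart (L s))) s hs) h) hε
    -- The exponent `z * n₀ + 1` is one modulo `z`, so it fixes the `z`-th roots of unity. Also `z *
    -- n₀ ≥ n₀`, so the uniform estimate, stated for exponents `n + 1`, applies.
    have hm : z * n₀ + 1 ≠ 0 := Nat.succ_ne_zero _
    have hroot : ∀ s ∈ Icc (0 : ℝ) 1, ∀ e ∈ peripheralSpectrum (L s), e ^ (z * n₀ + 1) = e := by
      intro s hs e he
      rw [hzL s hs, mem_unitRoots_iff (by lia)] at he
      rw [pow_succ, pow_mul, he, one_pow, one_mul]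
    have hbound : nonperipheralNorm (fun s => L s ^ (z * n₀ + 1)) ≤ ℓ := by
      refine iSup₂_le fun s hs => ?_
      rw [(hE s hs).nonperipheralPart_pow_eq hm (hroot s hs),
        ← ENNReal.ofReal_toReal hℓ1.ne_top, ← ofReal_norm]
      exact ENNReal.ofReal_le_ofReal
        (hn₀ _ (Nat.le_mul_of_pos_left n₀ hz1) s hs).le
    refine ⟨z * n₀ + 1, Nat.succ_le_succ (Nat.zero_le _), ⟨fun s hs => ?_, ?_, ?_, ?_⟩, hbound⟩
    · exact (norm_pow_le' _ (Nat.succ_pos _)).trans (pow_le_one₀ (norm_nonneg _) (hcontr s hs))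
    · refine hasPeripheralGap_of_forall_eq (S := unitRoots z) (fun s hs => ?_) fun s hs => ?_
      · rw [peripheralSpectrum_pow hm (hroot s hs), hzL s hs]
      · exact (hE s hs).pow hm (hroot s hs)
    · exact ContDiffOn.congr hP fun s hs => (hE s hs).peripheralPart_pow hm (hroot s hs)
    · exact hbound.trans_lt hℓ1
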